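/- **Definitions.** A *pattern* $P=\langle X,D,A,\mathrm{cpt}\rangle$ consists of a finite set $X$ of variables, a finite set $D$ of values, a set $A\subseteq X\times D$ of assignments such that each domain $\mathcal D(v)=\{a:\langle v,a\rangle\in A\}$ ($v\in X$) is non-empty, and a partial function $\mathrm{cpt}$ from unordered pairs of assignments to distinct variables to $\{\mathrm{TRUE},\mathrm{FALSE}\}$; pairs mapped to TRUE (FALSE) are compatibility (incompatibility) edges. A *quantified pattern* also has a distinguished variable $\bar v(P)\in X$ and a (possibly empty) set $e(P)\subseteq\mathcal D(\bar v(P))$ of existential values. Patterns are *equivalent* if they are identical up to injective renaming of variables and of assignments. A quantified pattern $P'=\langle X',D',A',\mathrm{cpt}'\rangle$ is a *sub-pattern* of $P$ if $X'\subseteq X$, $A'\subseteq A$, for all $p,q\in A'$ either $\mathrm{cpt}'(p,q)=\mathrm{cpt}(p,q)$ or $\mathrm{cpt}'(p,q)$ is undefined, $\bar v(P')=\bar v(P)$ and $e(P')\subseteq e(P)$. A value $a$ of a variable $v$ can be *merged* into another value $b$ of $v$ if no assignment $p$ has $\mathrm{cpt}(\langle v,a\rangle,p)$ and $\mathrm{cpt}(\langle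 v,b\rangle,p)$ both defined and different, and, when $v=\bar v(P)$, $a\in e(P)$ implies $b\in e(P)$; merging deletes $\langle v,a\rangle$ and gives $\langle v,b\rangle$, in addition to its own edges, the edges of $\langle v,a\rangle$. An assignment is *dangling* if it is not an existential value of $\bar v(P)$ and it belongs to no incompatibility edge and to at most one compatibility edge; a dangling reduction deletes a dangling assignment (even if it is the only value of its variable, whose domain is then empty). A *reduction* of $P$ is obtained by a finite (possibly empty) sequence of these operations; $P$ is *irreducible* if none of them can be performed. A *binary CSP instance* $I$ is a pattern for which $\mathrm{cpt}$ is defined on all pairs of assignments to distinct variables. A *partial solution* on $Y\subseteq X$ chooses $s(v)\in\mathcal D(v)$ for each $v\in Y$ so that the chosen assignments are pairwise compatible; a *solution* is a partial solution on $X$. $I$ is *arc-consistent* if for each assignment $\langle v,a\rangle$ and each variable $w\ne v$ some $b\in\mathcal D(w)$ has $\langle w,b\rangle$ compatible with $\langle v,a\rangle$. A variable $x$ *can be eliminated* in $I$ if the existence of a partial solution on $X\setminus\{x\}$ implies that of a solution. A quantified pattern $P$ *occurs at* a variable $x$ of $I$ *with value mapping* $m:e(P)\to\mathcal D(x)$ if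 some reduction of $P$ is equivalent to a sub-pattern of $I$ in which $x$ corresponds to $\bar v(P)$ and, for each $a\in e(P)$, the value $m(a)$ of $x$ corresponds to $a$. $P$ is a *var-elim pattern* (its absence allows variable elimination in arc-consistent instances) if, whenever $I$ is an arc-consistent binary CSP instance, $x$ is a variable of $I$, and there is an injective $m:e(P)\to\mathcal D(x)$ such that $P$ does not occur at $x$ with value mapping $m$, the variable $x$ can be eliminated in $I$. The following quantified patterns have variables $x,y,z$ and distinguished variable $x$; $T$ lists the compatibility edges and $F$ the incompatibility edges. - **BTP**: values $x_0,x_1$ for $x$, $y_0$ for $y$, $z_0$ for $z$; $T=\{y_0z_0,\ y_0x_1,\ z_0x_0\}$, $F=\{y_0x_0,\ z_0x_1\}$, $e=\emptyset$. - **∃subBTP**: values $x_0,x_1$; $y_0$; $z_0$; $T=\{y_0z_0,\ y_0x_1\}$, $F=\{y_0x_0,\ z_0x_1\}$, $e=\{x_0\}$. - **∃invsubBTP**: values $x_0$; $y_0,y_1$; $z_0$; $T=\{y_1x_0,\ z_0x_0\}$, $F=\{y_0x_0,\ z_0y_1\}$, $e=\{x_0\}$. - **∃snake**: values $x_0$;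 $y_0,y_1$; $z_0$; $T=\{y_1x_0,\ y_0z_0\}$, $F=\{y_0x_0,\ z_0y_1\}$, $e=\{x_0\}$. **Theorem.** The patterns BTP, ∃subBTP, ∃invsubBTP and ∃snake are irreducible var-elim patterns, and an irreducible quantified pattern is a var-elim pattern if and only if it is equivalent to a sub-pattern of one of these four. -/

import Mathlib

/-- Finite binary patterns whose variables are named in `V` and whose values are named in `D`.
`X` is the finite set of variables, `A` the finite set of possible assignments, and `cpt` the partial
compatibility function on unordered pairs of assignments to distinct variables: `some true` is a
compatibility edge, `some false` an incompatibility edge, `none` means undefined.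
Domains are allowed to be empty here, because a dangling reduction may remove the last value of a
domain; see `Pattern.NonemptyDomains`. -/
structure Pattern (V D : Type*) where
  X : Set V
  A : Set (V × D)
  cpt : V × D → V × D → Option Bool
  finite_X : X.Finite
  finite_A : A.Finite
  fst_mem : ∀ p ∈ A, p.1 ∈ X
  cpt_symm : ∀ p q, cpt p q = cpt q p
  cpt_dom : ∀ p q, cpt p q ≠ none → p ∈ A ∧ q ∈ A ∧ p.1 ≠ q.1

namespace Pattern

variable {V D : Type*}

/-- The domain of a variable. -/
def dom (P : Pattern V D) (v : V) : Set D := {a | (v, a) ∈ P.A}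

/-- Every variable has a non-empty domain. -/
def NonemptyDomains (P : Pattern V D) : Prop := ∀ v ∈ P.X, (P.dom v).Nonempty

/-- `P'` is a sub-pattern of `P` (no quantification). -/
def IsSubpattern (P' P : Pattern V D) : Prop :=
  P'.X ⊆ P.X ∧ P'.A ⊆ P.A ∧
    ∀ p ∈ P'.A, ∀ q ∈ P'.A, P'.cpt p q = P.cpt p q ∨ P'.cpt p q = none

open Classical in
/-- Delete the assignment `p`, restricting the compatibility function. -/
noncomputable def erase (P : Pattern V D) (p : V × D) : Pattern V D where
  X := P.X
  A := P.A \ {p}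
  cpt q r := if q = p ∨ r = p then none else P.cpt q r
  finite_X := P.finite_X
  finite_A := P.finite_A.sdiff
  fst_mem q hq := P.fst_mem q hq.1
  cpt_symm q r := by
    rw [P.cpt_symm q r]
    by_cases h1 : q = p <;> by_cases h2 : r = p <;> simp [h1, h2]
  cpt_dom q r h := by
    by_cases h1 : q = p
    · simp [h1] at h
    · by_cases h2 : r = p
      · simp [h2] at h
      · have h3 : P.cpt q r ≠ none := by simpa [h1, h2] using h
        obtain ⟨hq, hr, hn⟩ := P.cpt_dom q r h3
        exact ⟨⟨hq, by simpa using h1⟩, ⟨hr, by simpa using h2⟩, hn⟩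

open Classical in
/-- Copy to the assignment `(v, b)` those edges at `(v, a)` for which the corresponding edge at
`(v, b)` is undefined. -/
noncomputable def copyEdges (P : Pattern V D) (v : V) (a b : D) (hb : (v, b) ∈ P.A) :
    Pattern V D where
  X := P.X
  A := P.A
  cpt p q :=
    if p = (v, b) ∧ P.cpt p q = none then P.cpt (v, a) q
    else if q = (v, b) ∧ P.cpt p q = none then P.cpt p (v, a)
    else P.cpt p q
  finite_X := P.finite_X
  finite_A := P.finite_A
  fst_mem := P.fst_mem
  cpt_symm p q := by
    have hself : ∀ c d : D, P.cpt (v, c) (v, d) = none := by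
      intro c d
      by_contra h
      exact (P.cpt_dom _ _ h).2.2 rfl
    by_cases h : P.cpt p q = none
    · have h' : P.cpt q p = none := by rw [P.cpt_symm]; exact h
      by_cases h1 : p = (v, b)
      · by_cases h2 : q = (v, b)
        · simp [h1, h2, hself]
        · rw [if_pos ⟨h1, h⟩, if_neg (fun hh => h2 hh.1), if_pos ⟨h1, h'⟩, P.cpt_symm]
      · by_cases h2 : q = (v, b)
        · rw [if_neg (fun hh => h1 hh.1), if_pos ⟨h2, h⟩, if_pos ⟨h2, h'⟩, P.cpt_symm]
        · simp [h1, h2, P.cpt_symm q p]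
    · simp [h, P.cpt_symm q p]
  cpt_dom p q h := by
    by_cases h0 : P.cpt p q = none
    · by_cases h1 : p = (v, b)
      · subst h1
        have h2 : P.cpt (v, a) q ≠ none := by simpa [h0] using h
        obtain ⟨-, hq, hn⟩ := P.cpt_dom _ _ h2
        exact ⟨hb, hq, hn⟩
      · by_cases h2 : q = (v, b)
        · subst h2
          have h3 : P.cpt p (v, a) ≠ none := by simpa [h0, h1] using h
          obtain ⟨hp, -, hn⟩ := P.cpt_dom _ _ h3
          exact ⟨hp, hb, hn⟩
        · exact absurd h0 (by simpa [h1, h2] using h)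
    · exact P.cpt_dom p q h0

end Pattern

/-- A pattern with a distinguished variable `vbar` and a set `e` of existential values in the domain
of `vbar`. It is flat if `e = ∅` and existential otherwise. -/
structure QPattern (V D : Type*) extends Pattern V D where
  vbar : V
  e : Set D
  vbar_mem : vbar ∈ X
  e_subset : ∀ a ∈ e, (vbar, a) ∈ A

namespace QPattern

variable {V D W E : Type*}

/-- `P'` is a sub-pattern of `P` (as quantified patterns). -/
def IsSubpattern (P' P : QPattern V D) : Prop :=
  P'.toPattern.IsSubpattern P.toPattern ∧ P'.vbar = P.vbar ∧ P'.e ⊆ P.e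

/-- `φ` (on variables) and `ψ` (on assignments) are injective renamings that turn `P` into `Q`. -/
structure IsRenaming (P : QPattern V D) (Q : QPattern W E) (φ : V → W) (ψ : V × D → W × E) :
    Prop where
  vars : Set.BijOn φ P.X Q.X
  assigns : Set.BijOn ψ P.A Q.A
  fst : ∀ p ∈ P.A, (ψ p).1 = φ p.1
  cpt : ∀ p ∈ P.A, ∀ q ∈ P.A, Q.cpt (ψ p) (ψ q) = P.cpt p q
  vbar : φ P.vbar = Q.vbar
  exist : ∀ a ∈ P.dom P.vbar, (ψ (P.vbar, a)).2 ∈ Q.e ↔ a ∈ P.e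

/-- Equivalence (isomorphism) of quantified patterns. -/
def Equivalent (P : QPattern V D) (Q : QPattern W E) : Prop :=
  ∃ φ ψ, IsRenaming P Q φ ψ

/-- `P` is, up to equivalence, a sub-pattern of `Q`. -/
def IsSubpatternUpToEquiv (P : QPattern V D) (Q : QPattern W E) : Prop :=
  ∃ S : QPattern W E, S.IsSubpattern Q ∧ P.Equivalent S

/-- The value `a` of the variable `v` can be merged into the (different) value `b`. -/
structure Mergeable (P : QPattern V D) (v : V) (a b : D) : Prop where
  ne : a ≠ b
  left_mem : (v, a) ∈ P.A
  right_mem : (v, b) ∈ P.A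
  agree : ∀ p ∈ P.A, P.cpt (v, a) p ≠ none → P.cpt (v, b) p ≠ none →
    P.cpt (v, a) p = P.cpt (v, b) p
  exist : v = P.vbar → a ∈ P.e → b ∈ P.e

/-- `p` is a dangling assignment: at most one edge at `p`, which, if present, is a compatibility
edge, and `p` is not an existential value of the distinguished variable. -/
structure IsDangling (P : QPattern V D) (p : V × D) : Prop where
  mem : p ∈ P.A
  unique : ∀ q ∈ P.A, ∀ r ∈ P.A, P.cpt p q ≠ none → P.cpt p r ≠ none → q = r
  compat : ∀ q ∈ P.A, P.cpt p q ≠ some false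
  not_exist : ¬ (p.1 = P.vbar ∧ p.2 ∈ P.e)

/-- Delete an assignment (and the corresponding existential value, if any). -/
noncomputable def erase (P : QPattern V D) (p : V × D) : QPattern V D where
  toPattern := P.toPattern.erase p
  vbar := P.vbar
  e := {a | a ∈ P.e ∧ (P.vbar, a) ≠ p}
  vbar_mem := P.vbar_mem
  e_subset a ha := ⟨P.e_subset a ha.1, by simpa using ha.2⟩

/-- The merge reduction in which the value `a` of `v` is merged into `b`. -/
noncomputable def merge (P : QPattern V D) (v : V) (a b : D) (h : P.Mergeable v a b) :
    QPattern V D :=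
  erase
    { toPattern := P.toPattern.copyEdges v a b h.right_mem
      vbar := P.vbar
      e := P.e
      vbar_mem := P.vbar_mem
      e_subset := P.e_subset } (v, a)

open Classical in
/-- `P.ReducesTo Q f`: `Q` is obtained from `P` by a sequence of merge and dangling reductions, and
`f` follows the assignments of `P` that get merged into other assignments. -/
inductive ReducesTo (P : QPattern V D) : QPattern V D → (V × D → V × D) → Prop
  | refl : ReducesTo P P id
  | merge {Q : QPattern V D} {f : V × D → V × D} (v : V) (a b : D) (h : Q.Mergeable v a b) :
      ReducesTo P Q f →
        ReducesTo P (Q.merge v a b h) (fun p => if f p = (v, a) then (v, b) else f p)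
  | dangling {Q : QPattern V D} {f : V × D → V × D} (p : V × D) (h : Q.IsDangling p) :
      ReducesTo P Q f → ReducesTo P (Q.erase p) f

/-- No merge or dangling reduction can be performed. -/
def Irreducible (P : QPattern V D) : Prop :=
  (∀ v a b, ¬ P.Mergeable v a b) ∧ ∀ p, ¬ P.IsDangling p

end QPattern

/-- A binary CSP instance: a pattern (with non-empty domains) whose compatibility function is
total. -/
structure CSPInstance (W E : Type*) extends Pattern W E where
  nonempty_domains : toPattern.NonemptyDomains
  total : ∀ p ∈ A, ∀ q ∈ A, p.1 ≠ q.1 → cpt p q ≠ none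

namespace CSPInstance

variable {W E : Type*}

/-- Every assignment has a compatible assignment at every other variable. -/
def ArcConsistent (I : CSPInstance W E) : Prop :=
  ∀ p ∈ I.A, ∀ w ∈ I.X, w ≠ p.1 → ∃ b, (w, b) ∈ I.A ∧ I.cpt p (w, b) = some true

/-- `s` restricted to `Y` is a partial solution on `Y`. -/
def IsPartialSolution (I : CSPInstance W E) (Y : Set W) (s : W → E) : Prop :=
  (∀ v ∈ Y, s v ∈ I.dom v) ∧
    ∀ v ∈ Y, ∀ w ∈ Y, v ≠ w → I.cpt (v, s v) (w, s w) = some true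

/-- A solution is a partial solution on all the variables. -/
def IsSolution (I : CSPInstance W E) (s : W → E) : Prop := I.IsPartialSolution I.X s

/-- The variable `x` can be eliminated. -/
def CanEliminate (I : CSPInstance W E) (x : W) : Prop :=
  (∃ s, I.IsPartialSolution (I.X \ {x}) s) → ∃ s, I.IsSolution s

end CSPInstance

namespace QPattern

variable {V D W E : Type*}

/-- `P` occurs at the variable `x` of the instance `I` with value mapping `m`: some reduction of `P`
is equivalent to a sub-pattern `S` of `I` whose distinguished variable is `x`, and every existential
value `a` of `P` corresponds to the value `m a` of `x`. (Only the values of `m` on `P.e` matter.) -/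
def OccursAt (P : QPattern V D) (I : CSPInstance W E) (x : W) (m : D → E) : Prop :=
  ∃ (R : QPattern V D) (f : V × D → V × D) (S : QPattern W E) (φ : V → W) (ψ : V × D → W × E),
    P.ReducesTo R f ∧ R.IsRenaming S φ ψ ∧ S.toPattern.IsSubpattern I.toPattern ∧ S.vbar = x ∧
      ∀ a ∈ P.e, ψ (f (P.vbar, a)) = (x, m a)

/-- `P` is a variable elimination pattern. Patterns and instances are finite and only matter up to
renaming, so instances with names in types of the lowest universe are all the instances. -/
def IsVarElim (P : QPattern V D) : Prop :=
  ∀ (W E : Type) (I : CSPInstance W E), I.ArcConsistent → ∀ x ∈ I.X,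
    (∃ m : D → E, Set.MapsTo m P.e (I.dom x) ∧ Set.InjOn m P.e ∧ ¬ P.OccursAt I x m) →
      I.CanEliminate x

end QPattern

namespace VarElimPatterns

/-- Assignments of a pattern on three variables `x = 0`, `y = 1`, `z = 2`, with values `0`, `1`. -/
abbrev Asg := Fin 3 × Fin 2

/-- The compatibility function with compatibility edges `T` and incompatibility edges `F`. -/
def edges (T F : List (Asg × Asg)) (p q : Asg) : Option Bool :=
  if (p, q) ∈ T ∨ (q, p) ∈ T then some true
  else if (p, q) ∈ F ∨ (q, p) ∈ F then some false
  else none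

abbrev x0 : Asg := (0, 0)
abbrev x1 : Asg := (0, 1)
abbrev y0 : Asg := (1, 0)
abbrev y1 : Asg := (1, 1)
abbrev z0 : Asg := (2, 0)

/-- BTP, with distinguished variable `x`. -/
def BTP : QPattern (Fin 3) (Fin 2) where
  X := Set.univ
  A := {p | p ∈ [x0, x1, y0, z0]}
  cpt := edges [(y0, z0), (y0, x1), (z0, x0)] [(y0, x0), (z0, x1)]
  finite_X := Set.toFinite _
  finite_A := Set.toFinite _
  fst_mem _ _ := Set.mem_univ _
  cpt_symm := by decide
  cpt_dom := by simp only [Set.mem_ofPred_eq]; decide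
  vbar := 0
  e := ∅
  vbar_mem := Set.mem_univ _
  e_subset := by simp

/-- `∃subBTP`, with distinguished variable `x` and existential value `0`. -/
def existsSubBTP : QPattern (Fin 3) (Fin 2) where
  X := Set.univ
  A := {p | p ∈ [x0, x1, y0, z0]}
  cpt := edges [(y0, z0), (y0, x1)] [(y0, x0), (z0, x1)]
  finite_X := Set.toFinite _
  finite_A := Set.toFinite _
  fst_mem _ _ := Set.mem_univ _
  cpt_symm := by decide
  cpt_dom := by simp only [Set.mem_ofPred_eq]; decide
  vbar := 0
  e := {0}
  vbar_mem := Set.mem_univ _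
  e_subset := by simp

/-- `∃invsubBTP`, with distinguished variable `x` and existential value `0`. -/
def existsInvsubBTP : QPattern (Fin 3) (Fin 2) where
  X := Set.univ
  A := {p | p ∈ [x0, y0, y1, z0]}
  cpt := edges [(y1, x0), (z0, x0)] [(y0, x0), (z0, y1)]
  finite_X := Set.toFinite _
  finite_A := Set.toFinite _
  fst_mem _ _ := Set.mem_univ _
  cpt_symm := by decide
  cpt_dom := by simp only [Set.mem_ofPred_eq]; decide
  vbar := 0
  e := {0}
  vbar_mem := Set.mem_univ _
  e_subset := by simp

/-- `∃snake`, with distinguished variable `x` and existential value `0`. -/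
def existsSnake : QPattern (Fin 3) (Fin 2) where
  X := Set.univ
  A := {p | p ∈ [x0, y0, y1, z0]}
  cpt := edges [(y1, x0), (y0, z0)] [(y0, x0), (z0, y1)]
  finite_X := Set.toFinite _
  finite_A := Set.toFinite _
  fst_mem _ _ := Set.mem_univ _
  cpt_symm := by decide
  cpt_dom := by simp only [Set.mem_ofPred_eq]; decide
  vbar := 0
  e := {0}
  vbar_mem := Set.mem_univ _
  e_subset := by simp

/-- The four patterns. -/
def four : Set (QPattern (Fin 3) (Fin 2)) := {BTP, existsSubBTP, existsInvsubBTP, existsSnake}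

end VarElimPatterns

/-! An irreducible pattern has no reduction but itself, so it occurs in an instance exactly when it
maps there by a homomorphism. Injectivity on assignments is automatic, since two values with the
same image could be merged. Both occurrence and the sub-pattern relation thus become existence of a
homomorphism, and sufficiency passes from the four patterns to their irreducible sub-patterns by
composition.

The four patterns are treated directly. For BTP and `∃subBTP` a partial solution extends by a
suitable value of the variable to eliminate, a failure exhibiting the pattern. For the other two,
the existential value is imposed and the partial solution is repaired wherever it conflicts with
that value; a failure of the repair exhibits the pattern.

For necessity, a variable elimination pattern must occur in every arc-consistent instance in which a
variable cannot be eliminated. Occurring in a triangle of disequalities on two classes of values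
leaves at most three variables, at most two values for each and at most one existential value, and
makes the sign of an edge depend only on whether its ends have equal values. The pattern is thus
encoded by three 2×2 Boolean tables and a flag (`exists_isHom_triangle`). Four further unsolvable
instances forbid a short list of configurations of edges (`avoids_table`), irreducibility restricts
the tables further (`unreducible_table`), and an exhaustive check shows that every remaining table
embeds in one of the four patterns (`mapsToFour_ofCode`). -/

namespace QPattern

/-! ### Homomorphisms of irreducible patterns -/

variable {V D W E W' E' : Type*}

/-- `φ` (on variables) and `ψ` (on assignments) map `P` into `Q`, injectively on variables,
preserving all edges and sending the distinguished variable to `x`. -/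
structure IsHom (P : QPattern V D) (Q : Pattern W E) (x : W) (φ : V → W) (ψ : V × D → W × E) :
    Prop where
  inj : Set.InjOn φ P.X
  mapsTo_X : Set.MapsTo φ P.X Q.X
  mapsTo_A : Set.MapsTo ψ P.A Q.A
  fst : ∀ p ∈ P.A, (ψ p).1 = φ p.1
  cpt : ∀ p ∈ P.A, ∀ q ∈ P.A, P.cpt p q ≠ none → Q.cpt (ψ p) (ψ q) = P.cpt p q
  vbar : φ P.vbar = x

theorem IsHom.comp {P : QPattern V D} {Q : QPattern W E} {R : Pattern W' E'} {x : W'}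
    {φ : V → W} {ψ : V × D → W × E} {φ' : W → W'} {ψ' : W × E → W' × E'}
    (h' : Q.IsHom R x φ' ψ') (h : P.IsHom Q.toPattern Q.vbar φ ψ) :
    P.IsHom R x (φ' ∘ φ) (ψ' ∘ ψ) where
  inj := h'.inj.comp h.inj h.mapsTo_X
  mapsTo_X := h'.mapsTo_X.comp h.mapsTo_X
  mapsTo_A := h'.mapsTo_A.comp h.mapsTo_A
  fst p hp := by
    simp only [Function.comp_apply]
    rw [h'.fst _ (h.mapsTo_A hp), h.fst p hp]
  cpt p hp q hq hpq := by
    have h1 := h.cpt p hp q hq hpq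
    simp only [Function.comp_apply]
    rw [h'.cpt _ (h.mapsTo_A hp) _ (h.mapsTo_A hq) (by rwa [h1]), h1]
  vbar := by simp [h.vbar, h'.vbar]

/-- Two different values of a variable with the same image could be merged. -/
theorem IsHom.injOn {P : QPattern V D} {Q : Pattern W E} {x : W} {φ : V → W}
    {ψ : V × D → W × E} (h : P.IsHom Q x φ ψ) (hP : P.Irreducible) : Set.InjOn ψ P.A := by
  rintro ⟨v, a⟩ hp ⟨w, b⟩ hq hpq
  have hvw : v = w := by
    apply h.inj (P.fst_mem _ hp) (P.fst_mem _ hq)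
    have h1 := h.fst _ hp
    have h2 := h.fst _ hq
    rw [hpq, h2] at h1
    exact h1.symm
  subst hvw
  by_contra hne
  have hab : a ≠ b := fun hab => hne (by rw [hab])
  have key : ∀ r ∈ P.A, P.cpt (v, a) r ≠ none → P.cpt (v, b) r ≠ none →
      P.cpt (v, a) r = P.cpt (v, b) r := fun r hr h1 h2 => by
    rw [← h.cpt _ hp r hr h1, ← h.cpt _ hq r hr h2, hpq]
  -- Existential values can bar the merge in one direction only, so one of the two merges is always
  -- allowed.
  by_cases hb : a ∈ P.e → b ∈ P.e
  · exact hP.1 v a b ⟨hab, hp, hq, key, fun _ => hb⟩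
  · rw [Classical.not_imp] at hb
    exact hP.1 v b a ⟨hab.symm, hq, hp, fun r hr h1 h2 => (key r hr h2 h1).symm, fun _ _ => hb.1⟩

theorem ReducesTo.eq_of_irreducible {P R : QPattern V D} {f : V × D → V × D}
    (h : P.ReducesTo R f) (hP : P.Irreducible) : R = P ∧ f = id := by
  induction h with
  | refl => exact ⟨rfl, rfl⟩
  | merge v a b h _ ih => exact absurd (ih.1 ▸ h) (hP.1 v a b)
  | dangling p h _ ih => exact absurd (ih.1 ▸ h) (hP.2 p)

open Classical in
/-- The image of an injective homomorphism is a sub-pattern. -/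
theorem IsHom.exists_isRenaming {P : QPattern V D} {Q : Pattern W E} {x : W} {φ : V → W}
    {ψ : V × D → W × E} (h : P.IsHom Q x φ ψ) (hψ : Set.InjOn ψ P.A) :
    ∃ S : QPattern W E, P.IsRenaming S φ ψ ∧ S.toPattern.IsSubpattern Q ∧ S.vbar = x ∧
      ∀ b ∈ S.e, ∃ a ∈ P.e, ψ (P.vbar, a) = (x, b) := by
  -- The compatibility function is carried over through chosen preimages; injectivity of `ψ` makes
  -- the choice immaterial.
  let c : W × E → W × E → Option Bool := fun r s =>
    if hrs : ∃ p q, p ∈ P.A ∧ q ∈ P.A ∧ ψ p = r ∧ ψ q = s then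
      P.cpt hrs.choose hrs.choose_spec.choose else none
  have hc : ∀ p ∈ P.A, ∀ q ∈ P.A, c (ψ p) (ψ q) = P.cpt p q := by
    intro p hp q hq
    have hrs : ∃ p' q', p' ∈ P.A ∧ q' ∈ P.A ∧ ψ p' = ψ p ∧ ψ q' = ψ q :=
      ⟨p, q, hp, hq, rfl, rfl⟩
    simp only [c, dif_pos hrs]
    obtain ⟨h1, h2, h3, h4⟩ := hrs.choose_spec.choose_spec
    exact congrArg₂ P.cpt (hψ h1 hp h3) (hψ h2 hq h4)
  have hc' : ∀ r s, c r s ≠ none → ∃ p ∈ P.A, ∃ q ∈ P.A, ψ p = r ∧ ψ q = s := by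
    intro r s hrs
    by_contra hcon
    apply hrs
    apply dif_neg
    rintro ⟨p, q, hp, hq, h1, h2⟩
    exact hcon ⟨p, hp, q, hq, h1, h2⟩
  have hfst : ∀ a, (P.vbar, a) ∈ P.A → ψ (P.vbar, a) = (x, (ψ (P.vbar, a)).2) := fun a ha =>
    Prod.ext ((h.fst _ ha).trans h.vbar) rfl
  refine ⟨
    { X := φ '' P.X
      A := ψ '' P.A
      cpt := c
      finite_X := P.finite_X.image _
      finite_A := P.finite_A.image _
      fst_mem := ?_
      cpt_symm := ?_
      cpt_dom := ?_
      vbar := x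
      e := {b | ∃ a ∈ P.e, ψ (P.vbar, a) = (x, b)}
      vbar_mem := ⟨_, P.vbar_mem, h.vbar⟩
      e_subset := ?_ }, ?_, ?_, rfl, fun _ hb => hb⟩
  · rintro _ ⟨p, hp, rfl⟩
    exact ⟨p.1, P.fst_mem p hp, (h.fst p hp).symm⟩
  · intro r s
    by_cases hrs : c r s = none
    · by_contra hcon
      obtain ⟨p, hp, q, hq, rfl, rfl⟩ := hc' s r (fun h0 => hcon (hrs.trans h0.symm))
      rw [hc _ hp _ hq, hc _ hq _ hp, P.cpt_symm] at hcon
      exact hcon rfl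
    · obtain ⟨p, hp, q, hq, rfl, rfl⟩ := hc' r s hrs
      rw [hc _ hp _ hq, hc _ hq _ hp, P.cpt_symm]
  · intro r s hrs
    obtain ⟨p, hp, q, hq, rfl, rfl⟩ := hc' r s hrs
    rw [hc _ hp _ hq] at hrs
    refine ⟨⟨p, hp, rfl⟩, ⟨q, hq, rfl⟩, fun h1 => (P.cpt_dom _ _ hrs).2.2 ?_⟩
    rw [h.fst p hp, h.fst q hq] at h1
    exact h.inj (P.fst_mem _ hp) (P.fst_mem _ hq) h1
  · rintro b ⟨a, ha, hab⟩
    exact ⟨_, P.e_subset a ha, hab⟩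
  · refine ⟨h.inj.bijOn_image, hψ.bijOn_image, h.fst, hc, h.vbar, fun a ha => ?_⟩
    constructor
    · rintro ⟨a', ha', haa⟩
      have := hψ (P.e_subset _ ha') ha (haa.trans (hfst a ha).symm)
      have haa' : a' = a := (Prod.ext_iff.1 this).2
      exact haa' ▸ ha'
    · exact fun hae => ⟨a, hae, hfst a ha⟩
  · refine ⟨h.mapsTo_X.image_subset, h.mapsTo_A.image_subset, ?_⟩
    rintro _ ⟨p, hp, rfl⟩ _ ⟨q, hq, rfl⟩
    by_cases hpq : P.cpt p q = none
    · exact Or.inr ((hc p hp q hq).trans hpq)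
    · exact Or.inl ((hc p hp q hq).trans (h.cpt p hp q hq hpq).symm)

theorem IsRenaming.isHom {P : QPattern V D} {S : QPattern W E} {Q : Pattern W E}
    {φ : V → W} {ψ : V × D → W × E} (h : P.IsRenaming S φ ψ) (hS : S.toPattern.IsSubpattern Q) :
    P.IsHom Q S.vbar φ ψ where
  inj := h.vars.injOn
  mapsTo_X := h.vars.mapsTo.mono_right hS.1
  mapsTo_A := h.assigns.mapsTo.mono_right hS.2.1
  fst := h.fst
  cpt p hp q hq hpq := by
    have h1 := h.cpt p hp q hq
    have h2 := hS.2.2 _ (h.assigns.mapsTo hp) _ (h.assigns.mapsTo hq)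
    rw [h1] at h2
    exact (h2.resolve_right hpq).symm
  vbar := h.vbar

/-- The only reduction is the trivial one, and the image of a homomorphism is a faithful copy
because the homomorphism is injective on assignments. -/
theorem Irreducible.occursAt_iff {P : QPattern V D} (hP : P.Irreducible) {I : CSPInstance W E}
    {x : W} {m : D → E} :
    P.OccursAt I x m ↔
      ∃ φ ψ, P.IsHom I.toPattern x φ ψ ∧ ∀ a ∈ P.e, ψ (P.vbar, a) = (x, m a) := by
  constructor
  · rintro ⟨R, f, S, φ, ψ, hR, hS, hSI, hx, hm⟩
    obtain ⟨rfl, rfl⟩ := hR.eq_of_irreducible hP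
    exact ⟨φ, ψ, hx ▸ hS.isHom hSI, hm⟩
  · rintro ⟨φ, ψ, h, hm⟩
    obtain ⟨S, hS, hSI, hx, -⟩ := h.exists_isRenaming (h.injOn hP)
    exact ⟨P, id, S, φ, ψ, .refl, hS, hSI, hx, hm⟩

theorem Irreducible.isSubpatternUpToEquiv_iff {P : QPattern V D} (hP : P.Irreducible)
    {Q : QPattern W E} :
    P.IsSubpatternUpToEquiv Q ↔
      ∃ φ ψ, P.IsHom Q.toPattern Q.vbar φ ψ ∧ ∀ a ∈ P.e, (ψ (P.vbar, a)).2 ∈ Q.e := by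
  constructor
  · rintro ⟨S, ⟨hS, hv, he⟩, φ, ψ, h⟩
    exact ⟨φ, ψ, hv ▸ h.isHom hS, fun a ha => he ((h.exist a (P.e_subset a ha)).2 ha)⟩
  · rintro ⟨φ, ψ, h, hm⟩
    obtain ⟨S, hS, hSI, hx, he⟩ := h.exists_isRenaming (h.injOn hP)
    refine ⟨S, ⟨hSI, hx, fun b hb => ?_⟩, φ, ψ, hS⟩
    obtain ⟨a, ha, hab⟩ := he b hb
    have := hm a ha
    rwa [hab] at this

/-- A sub-pattern of a variable elimination pattern with at most one existential value is a
variable elimination pattern. -/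
theorem IsVarElim.of_isSubpatternUpToEquiv {P : QPattern V D} {Q : QPattern W E}
    (hP : P.Irreducible) (hQ : Q.Irreducible) (h : Q.IsVarElim) (he : Q.e.Subsingleton)
    (hPQ : P.IsSubpatternUpToEquiv Q) : P.IsVarElim := by
  obtain ⟨φ, ψ, hom, hm⟩ := hP.isSubpatternUpToEquiv_iff.1 hPQ
  intro W₁ E₁ I hI x hx ⟨m, hm1, hm2, hno⟩
  -- Since `Q` has at most one existential value and `ψ` is injective, so does `P`. The mapping for
  -- `Q` is the constant `b`: the image of that value, or anything in the domain if there is none.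
  obtain ⟨b, hb, hbm⟩ : ∃ b ∈ I.dom x, ∀ a ∈ P.e, m a = b := by
    rcases P.e.eq_empty_or_nonempty with h0 | ⟨a, ha⟩
    · obtain ⟨b, hb⟩ := I.nonempty_domains x hx
      exact ⟨b, hb, by simp [h0]⟩
    · refine ⟨m a, hm1 ha, fun a' ha' => congrArg m ?_⟩
      have h1 := hom.fst _ (P.e_subset a ha)
      have h2 := hom.fst _ (P.e_subset a' ha')
      have h3 := hom.injOn hP (P.e_subset a' ha') (P.e_subset a ha)
        (Prod.ext (h2.trans h1.symm) (he (hm a' ha') (hm a ha)))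
      exact (Prod.ext_iff.1 h3).2
  refine h W₁ E₁ I hI x hx ⟨fun _ => b, fun _ _ => hb, fun a ha a' ha' _ => he ha ha', ?_⟩
  rw [hQ.occursAt_iff]
  rintro ⟨φ', ψ', hom', hm'⟩
  refine hno (hP.occursAt_iff.2 ⟨φ' ∘ φ, ψ' ∘ ψ, hom'.comp hom, fun a ha => ?_⟩)
  have h1 : ψ (P.vbar, a) = (Q.vbar, (ψ (P.vbar, a)).2) :=
    Prod.ext ((hom.fst _ (P.e_subset a ha)).trans hom.vbar) rfl
  rw [Function.comp_apply, h1, hm' _ (hm a ha), hbm a ha]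

end QPattern

/-! ### Extending and repairing partial solutions -/

theorem Pattern.cpt_ne_none_mem {V D : Type*} (P : Pattern V D) {p q : V × D} {b : Bool}
    (h : P.cpt p q = some b) : p ∈ P.A ∧ q ∈ P.A ∧ p.1 ≠ q.1 :=
  P.cpt_dom p q (by simp [h])

namespace CSPInstance

variable {W E : Type*} {I : CSPInstance W E} {x : W} {s : W → E}

theorem cpt_eq_false {p q : W × E} (hp : p ∈ I.A) (hq : q ∈ I.A) (hpq : p.1 ≠ q.1)
    (h : I.cpt p q ≠ some true) : I.cpt p q = some false := by
  have h1 := I.total p hp q hq hpq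
  rcases hc : I.cpt p q with _ | _ | _ <;> simp_all

/-- A compatible value of `x` extends a partial solution on the other variables. -/
theorem IsPartialSolution.exists_isSolution (hs : I.IsPartialSolution (I.X \ {x}) s) {a : E}
    (ha : a ∈ I.dom x) (h : ∀ v ∈ I.X, v ≠ x → I.cpt (v, s v) (x, a) = some true) :
    ∃ t, I.IsSolution t := by
  classical
  refine ⟨Function.update s x a, fun v hv => ?_, fun v hv w hw hvw => ?_⟩
  · by_cases hx : v = x
    · subst hx; simpa using ha
    · simpa [hx] using hs.1 v ⟨hv, hx⟩
  · by_cases hx : v = x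
    · subst hx
      rw [I.cpt_symm]
      simpa [hvw.symm] using h w hw hvw.symm
    · by_cases hx' : w = x
      · subst hx'
        simpa [hvw] using h v hv hvw
      · simpa [hx, hx'] using hs.2 v ⟨hv, hx⟩ w ⟨hw, hx'⟩ hvw

/-- A partial solution can be changed at the variables where it is incompatible with `(x, a)`. -/
theorem IsPartialSolution.exists_repair (hI : I.ArcConsistent)
    (hs : I.IsPartialSolution (I.X \ {x}) s) {a : E} (ha : a ∈ I.dom x) :
    ∃ t : W → E, (∀ v ∈ I.X, v ≠ x → I.cpt (v, t v) (x, a) = some true) ∧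
      ∀ v ∈ I.X, v ≠ x → t v = s v ∨ I.cpt (v, s v) (x, a) = some false := by
  have h : ∀ v, ∃ c, v ∈ I.X → v ≠ x → I.cpt (v, c) (x, a) = some true ∧
      (c = s v ∨ I.cpt (v, s v) (x, a) = some false) := by
    intro v
    by_cases hv : v ∈ I.X ∧ v ≠ x
    · by_cases hc : I.cpt (v, s v) (x, a) = some true
      · exact ⟨s v, fun _ _ => ⟨hc, Or.inl rfl⟩⟩
      · obtain ⟨c, -, hcc⟩ := hI (x, a) ha v hv.1 hv.2
        rw [I.cpt_symm] at hcc
        exact ⟨c, fun _ _ => ⟨hcc, Or.inr (cpt_eq_false (hs.1 v hv) ha hv.2 hc)⟩⟩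
    · exact ⟨s v, fun h1 h2 => absurd ⟨h1, h2⟩ hv⟩
  choose t ht using h
  exact ⟨t, fun v hv hx => (ht v hv hx).1, fun v hv hx => (ht v hv hx).2⟩

theorem exists_isSolution_of_repair {a : E} (ha : a ∈ I.dom x) {t : W → E}
    (h : ∀ v ∈ I.X, v ≠ x → I.cpt (v, t v) (x, a) = some true)
    (ht : ∀ v ∈ I.X, v ≠ x → ∀ w ∈ I.X, w ≠ x → v ≠ w → I.cpt (v, t v) (w, t w) ≠ some false) :
    ∃ t, I.IsSolution t := by
  have hdom : ∀ v ∈ I.X, v ≠ x → t v ∈ I.dom v := fun v hv hx =>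
    (I.cpt_ne_none_mem (h v hv hx)).1
  refine IsPartialSolution.exists_isSolution (x := x) (s := t)
    ⟨fun v hv => hdom v hv.1 hv.2, fun v hv w hw hvw => ?_⟩ ha h
  by_contra hc
  exact ht v hv.1 hv.2 w hw.1 hw.2 hvw
    (cpt_eq_false (hdom v hv.1 hv.2) (hdom w hw.1 hw.2) hvw hc)

end CSPInstance

/-! ### The four patterns are irreducible and allow variable elimination -/

theorem QPattern.irreducible_of_conflicts {V D : Type*} {P : QPattern V D}
    (h1 : ∀ v a b, a ≠ b → (v, a) ∈ P.A → (v, b) ∈ P.A →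
      ∃ p ∈ P.A, P.cpt (v, a) p ≠ none ∧ P.cpt (v, b) p ≠ none ∧ P.cpt (v, a) p ≠ P.cpt (v, b) p)
    (h2 : ∀ p ∈ P.A, ∃ q ∈ P.A, P.cpt p q = some false) : P.Irreducible := by
  refine ⟨fun v a b h => ?_, fun p h => ?_⟩
  · obtain ⟨p, hp, ha, hb, hab⟩ := h1 v a b h.ne h.left_mem h.right_mem
    exact hab (h.agree p hp ha hb)
  · obtain ⟨q, hq, hpq⟩ := h2 p h.mem
    exact h.compat q hq hpq

namespace VarElimPatterns

open QPattern

theorem edges_eq_true {T F : List (Asg × Asg)} {p q : Asg} (h : edges T F p q = some true) :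
    (p, q) ∈ T ∨ (q, p) ∈ T := by
  unfold edges at h
  split_ifs at h with h1 <;> simp_all

theorem edges_eq_false {T F : List (Asg × Asg)} {p q : Asg} (h : edges T F p q = some false) :
    (p, q) ∈ F ∨ (q, p) ∈ F := by
  unfold edges at h
  split_ifs at h with h1 h2 <;> simp_all

/-- To find one of the patterns in an instance, it suffices to find its edges. -/
theorem isHom_of_edges {W E : Type*} {Q : QPattern (Fin 3) (Fin 2)} {T F : List (Asg × Asg)}
    {I : Pattern W E} {x y z : W} {val : Fin 3 → Fin 2 → E}
    (hQ : Q.cpt = edges T F) (hv : Q.vbar = 0)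
    (hA : ∀ p ∈ Q.A, ∃ q ∈ Q.A, Q.cpt p q = some false)
    (hA' : ∀ v, ∃ a, (v, a) ∈ Q.A)
    (hxy : x ≠ y) (hxz : x ≠ z) (hyz : y ≠ z)
    (hT : ∀ e ∈ T, I.cpt (![x, y, z] e.1.1, val e.1.1 e.1.2) (![x, y, z] e.2.1, val e.2.1 e.2.2)
      = some true)
    (hF : ∀ e ∈ F, I.cpt (![x, y, z] e.1.1, val e.1.1 e.1.2) (![x, y, z] e.2.1, val e.2.1 e.2.2)
      = some false) :
    Q.IsHom I x ![x, y, z] (fun p => (![x, y, z] p.1, val p.1 p.2)) := by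
  have hc : ∀ p q, Q.cpt p q ≠ none →
      I.cpt (![x, y, z] p.1, val p.1 p.2) (![x, y, z] q.1, val q.1 q.2) = Q.cpt p q := by
    intro p q hpq
    rw [hQ] at hpq ⊢
    rcases hb : edges T F p q with _ | _ | _
    · exact absurd hb hpq
    · rcases edges_eq_false hb with h | h
      · exact hF _ h
      · rw [I.cpt_symm]; exact hF _ h
    · rcases edges_eq_true hb with h | h
      · exact hT _ h
      · rw [I.cpt_symm]; exact hT _ h
  -- Each assignment of `Q` lies on an edge, and edges of `I` join only assignments of `I`.
  have hmem : ∀ p ∈ Q.A, (![x, y, z] p.1, val p.1 p.2) ∈ I.A := by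
    intro p hp
    obtain ⟨q, -, hq⟩ := hA p hp
    exact (I.cpt_ne_none_mem ((hc p q (by simp [hq])).trans hq)).1
  refine ⟨?_, fun v _ => ?_, hmem, fun _ _ => rfl, fun p _ q _ => hc p q, by rw [hv]; rfl⟩
  · apply Function.Injective.injOn
    intro i j
    fin_cases i <;> fin_cases j <;> simp [hxy, hxz, hyz, hxy.symm, hxz.symm, hyz.symm]
  · obtain ⟨a, ha⟩ := hA' v
    exact I.fst_mem _ (hmem _ ha)

theorem exists_false_edge {Q : QPattern (Fin 3) (Fin 2)} (hQ : Q ∈ four) :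
    ∀ p ∈ Q.A, ∃ q ∈ Q.A, Q.cpt p q = some false := by
  rcases hQ with rfl | rfl | rfl | rfl <;>
    simp only [BTP, existsSubBTP, existsInvsubBTP, existsSnake, Set.mem_ofPred_eq] <;> decide

theorem irreducible_of_mem_four {Q : QPattern (Fin 3) (Fin 2)} (hQ : Q ∈ four) :
    Q.Irreducible := by
  refine irreducible_of_conflicts ?_ (exists_false_edge hQ)
  rcases hQ with rfl | rfl | rfl | rfl <;>
    simp only [BTP, existsSubBTP, existsInvsubBTP, existsSnake, Set.mem_ofPred_eq] <;> decide

/-- Take `y` whose value `s y` has the fewest supports at `x`. Without BTP the support sets are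
nested, so any support of `s y` supports every other value of the partial solution. -/
theorem isVarElim_BTP : BTP.IsVarElim := by
  rintro W E I hI x hx ⟨m, -, -, hno⟩ ⟨s, hs⟩
  rw [(irreducible_of_mem_four (by simp [four])).occursAt_iff] at hno
  let S : W → Set E := fun v => {a | I.cpt (v, s v) (x, a) = some true}
  have hSfin : ∀ v, (S v).Finite := fun v =>
    (I.finite_A.image Prod.snd).subset fun a ha => ⟨(x, a), (I.cpt_ne_none_mem ha).2.1, rfl⟩
  rcases (I.X \ {x}).eq_empty_or_nonempty with h0 | h0
  · obtain ⟨a, ha⟩ := I.nonempty_domains x hx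
    refine hs.exists_isSolution ha fun v hv hvx => ?_
    have : v ∈ I.X \ {x} := ⟨hv, hvx⟩
    simp [h0] at this
  · obtain ⟨y, hy, hmin⟩ :=
      Set.exists_min_image (I.X \ {x}) (fun v => (S v).ncard) I.finite_X.sdiff h0
    obtain ⟨a, ha, hya⟩ := hI (y, s y) (hs.1 y hy) x hx (Ne.symm hy.2)
    refine hs.exists_isSolution ha fun z hz hzx => ?_
    by_contra hza
    have hyz : y ≠ z := by rintro rfl; exact hza hya
    -- Otherwise `S z` would be strictly smaller than `S y`, as `a` lies in `S y` but not in `S z`.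
    obtain ⟨b, hb, hyb⟩ : ∃ b ∈ S z, b ∉ S y := by
      by_contra! hsub
      have hlt : S z ⊂ S y := ⟨hsub, fun h => hza (h hya)⟩
      exact absurd (hmin z ⟨hz, hzx⟩) (not_le.2 (Set.ncard_lt_ncard hlt (hSfin y)))
    have hbx : b ∈ I.dom x := (I.cpt_ne_none_mem hb).2.1
    have hzaF := CSPInstance.cpt_eq_false (hs.1 z ⟨hz, hzx⟩) ha hzx hza
    have hybF := CSPInstance.cpt_eq_false (hs.1 y hy) hbx hy.2 hyb
    refine hno ⟨_, _, isHom_of_edges (val := ![![b, a], fun _ => s y, fun _ => s z]) rfl rfl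
      (exists_false_edge (by simp [four])) (by simp only [BTP, Set.mem_ofPred_eq]; decide)
      (Ne.symm hy.2) (Ne.symm hzx) hyz ?_ ?_, by simp [BTP]⟩
    · simpa using ⟨hs.2 y hy z ⟨hz, hzx⟩ hyz, hya, hb⟩
    · simpa using ⟨hybF, hzaF⟩

/-- If `m 0` does not extend the partial solution, it conflicts with some `s y`; then any support of
`s y` at `x` extends it, since a conflict at a further variable would complete the pattern. -/
theorem isVarElim_existsSubBTP : existsSubBTP.IsVarElim := by
  rintro W E I hI x hx ⟨m, hm, -, hno⟩ ⟨s, hs⟩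
  rw [(irreducible_of_mem_four (by simp [four])).occursAt_iff] at hno
  have ha : m 0 ∈ I.dom x := hm rfl
  by_cases hall : ∀ v ∈ I.X, v ≠ x → I.cpt (v, s v) (x, m 0) = some true
  · exact hs.exists_isSolution ha hall
  push Not at hall
  obtain ⟨y, hy, hyx, hya⟩ := hall
  obtain ⟨b, hb, hyb⟩ := hI (y, s y) (hs.1 y ⟨hy, hyx⟩) x hx (Ne.symm hyx)
  refine hs.exists_isSolution hb fun z hz hzx => ?_
  by_contra hzb
  have hyz : y ≠ z := by rintro rfl; exact hzb hyb
  have hyaF := CSPInstance.cpt_eq_false (hs.1 y ⟨hy, hyx⟩) ha hyx hya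
  have hzbF := CSPInstance.cpt_eq_false (hs.1 z ⟨hz, hzx⟩) hb hzx hzb
  refine hno ⟨_, _, isHom_of_edges (val := ![![m 0, b], fun _ => s y, fun _ => s z]) rfl rfl
    (exists_false_edge (by simp [four])) (by simp only [existsSubBTP, Set.mem_ofPred_eq]; decide)
    (Ne.symm hyx) (Ne.symm hzx) hyz ?_ ?_, by simp [existsSubBTP]⟩
  · simpa using ⟨hs.2 y ⟨hy, hyx⟩ z ⟨hz, hzx⟩ hyz, hyb⟩
  · simpa using ⟨hyaF, hzbF⟩

/-- In the repaired assignment two incompatible values cannot both be original. The original and new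
values at a changed variable, with the value at the other one, form the pattern. -/
theorem isVarElim_existsInvsubBTP : existsInvsubBTP.IsVarElim := by
  rintro W E I hI x hx ⟨m, hm, -, hno⟩ ⟨s, hs⟩
  rw [(irreducible_of_mem_four (by simp [four])).occursAt_iff] at hno
  have ha : m 0 ∈ I.dom x := hm rfl
  obtain ⟨t, ht, hts⟩ := hs.exists_repair hI ha
  have key : ∀ y ∈ I.X, y ≠ x → ∀ z ∈ I.X, z ≠ x → y ≠ z →
      I.cpt (y, s y) (x, m 0) = some false → I.cpt (z, t z) (y, t y) ≠ some false := by
    intro y hy hyx z hz hzx hyz hya hzy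
    refine hno ⟨_, _, isHom_of_edges (val := ![fun _ => m 0, ![s y, t y], fun _ => t z]) rfl rfl
      (exists_false_edge (by simp [four]))
      (by simp only [existsInvsubBTP, Set.mem_ofPred_eq]; decide)
      (Ne.symm hyx) (Ne.symm hzx) hyz ?_ ?_, by simp [existsInvsubBTP]⟩
    · simpa using ⟨ht y hy hyx, ht z hz hzx⟩
    · simpa using ⟨hya, hzy⟩
  refine CSPInstance.exists_isSolution_of_repair ha ht fun y hy hyx z hz hzx hyz => ?_
  rcases hts y hy hyx with h1 | h1
  · rcases hts z hz hzx with h2 | h2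
    · rw [h1, h2, hs.2 y ⟨hy, hyx⟩ z ⟨hz, hzx⟩ hyz]
      simp
    · exact key z hz hzx y hy hyx hyz.symm h2
  · rw [I.cpt_symm]
    exact key y hy hyx z hz hzx hyz h1

/-- Without the pattern, `t y` is compatible with every value, at any other variable except `x`,
that is compatible with `s y`. The repair can therefore be done one variable at a time: from `s y`,
`s z` to `t y`, `s z` to `t y`, `t z`. -/
theorem isVarElim_existsSnake : existsSnake.IsVarElim := by
  rintro W E I hI x hx ⟨m, hm, -, hno⟩ ⟨s, hs⟩
  rw [(irreducible_of_mem_four (by simp [four])).occursAt_iff] at hno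
  have ha : m 0 ∈ I.dom x := hm rfl
  obtain ⟨t, ht, hts⟩ := hs.exists_repair hI ha
  have key : ∀ y ∈ I.X, y ≠ x → ∀ z ∈ I.X, z ≠ x → y ≠ z → ∀ c ∈ I.dom z,
      I.cpt (y, s y) (z, c) = some true → I.cpt (y, t y) (z, c) = some true := by
    intro y hy hyx z hz hzx hyz c hc hyc
    rcases hts y hy hyx with h1 | h1
    · rwa [h1]
    by_contra hcon
    have hF := CSPInstance.cpt_eq_false (I.cpt_ne_none_mem (ht y hy hyx)).1 hc hyz hcon
    rw [I.cpt_symm] at hF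
    refine hno ⟨_, _, isHom_of_edges (val := ![fun _ => m 0, ![s y, t y], fun _ => c]) rfl rfl
      (exists_false_edge (by simp [four])) (by simp only [existsSnake, Set.mem_ofPred_eq]; decide)
      (Ne.symm hyx) (Ne.symm hzx) hyz ?_ ?_, by simp [existsSnake]⟩
    · simpa using ⟨ht y hy hyx, hyc⟩
    · simpa using ⟨h1, hF⟩
  refine CSPInstance.exists_isSolution_of_repair ha ht fun y hy hyx z hz hzx hyz => ?_
  have h1 := key y hy hyx z hz hzx hyz (s z) (hs.1 z ⟨hz, hzx⟩)
    (hs.2 y ⟨hy, hyx⟩ z ⟨hz, hzx⟩ hyz)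
  rw [I.cpt_symm] at h1
  rw [I.cpt_symm, key z hz hzx y hy hyx hyz.symm (t y) (I.cpt_ne_none_mem (ht y hy hyx)).1 h1]
  simp

theorem isVarElim_of_mem_four {Q : QPattern (Fin 3) (Fin 2)} (hQ : Q ∈ four) : Q.IsVarElim := by
  rcases hQ with rfl | rfl | rfl | rfl
  · exact isVarElim_BTP
  · exact isVarElim_existsSubBTP
  · exact isVarElim_existsInvsubBTP
  · exact isVarElim_existsSnake

theorem subsingleton_e_of_mem_four {Q : QPattern (Fin 3) (Fin 2)} (hQ : Q ∈ four) :
    Q.e.Subsingleton := by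
  rcases hQ with rfl | rfl | rfl | rfl <;>
    simp [BTP, existsSubBTP, existsInvsubBTP, existsSnake]

end VarElimPatterns

/-! ### Instances given by a total relation -/

namespace CSPInstance

/-- The instance with variables `W`, all of whose domains are `E`, with compatibility given by
`r`. -/
def ofRel {W E : Type*} [Finite W] [Finite E] [Nonempty E] [DecidableEq W]
    (r : W × E → W × E → Bool) (hr : ∀ p q, p.1 ≠ q.1 → r p q = r q p) : CSPInstance W E where
  X := Set.univ
  A := Set.univ
  cpt p q := if p.1 = q.1 then none else some (r p q)
  finite_X := Set.toFinite _
  finite_A := Set.toFinite _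
  fst_mem _ _ := Set.mem_univ _
  cpt_symm p q := by
    by_cases h : p.1 = q.1
    · simp [h]
    · simp [h, Ne.symm h, hr p q h]
  cpt_dom p q h := ⟨Set.mem_univ _, Set.mem_univ _, fun h1 => h (if_pos h1)⟩
  nonempty_domains _ _ := ⟨Classical.arbitrary E, Set.mem_univ _⟩
  total p _ q _ h := by simp [h]

section

variable {W E : Type*} [Finite W] [Finite E] [Nonempty E] [DecidableEq W]
  {r : W × E → W × E → Bool} {hr : ∀ p q, p.1 ≠ q.1 → r p q = r q p}

theorem ofRel_cpt_eq_some {p q : W × E} {b : Bool} :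
    (ofRel r hr).cpt p q = some b ↔ p.1 ≠ q.1 ∧ r p q = b := by
  simp [ofRel]

theorem ofRel_arcConsistent (h : ∀ v a w, w ≠ v → ∃ b, r (v, a) (w, b) = true) :
    (ofRel r hr).ArcConsistent := by
  rintro ⟨v, a⟩ - w - hw
  obtain ⟨b, hb⟩ := h v a w hw
  exact ⟨b, Set.mem_univ _, ofRel_cpt_eq_some.2 ⟨hw.symm, hb⟩⟩

theorem ofRel_not_canEliminate {x : W} (s : W → E)
    (hs : ∀ v w, v ≠ x → w ≠ x → v ≠ w → r (v, s v) (w, s w) = true)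
    (h : ∀ t : W → E, ∃ v w, v ≠ w ∧ r (v, t v) (w, t w) = false) :
    ¬ (ofRel r hr).CanEliminate x := by
  intro hx
  obtain ⟨t, -, ht⟩ := hx ⟨s, fun _ _ => Set.mem_univ _, fun v hv w hw hvw =>
    ofRel_cpt_eq_some.2 ⟨hvw, hs v w hv.2 hw.2 hvw⟩⟩
  obtain ⟨v, w, hvw, hr⟩ := h t
  have := (ofRel_cpt_eq_some.1 (ht v (Set.mem_univ _) w (Set.mem_univ _) hvw)).2
  simp [hr] at this

end

end CSPInstance

namespace QPattern

open CSPInstance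

variable {V D : Type*} {P : QPattern V D}

theorem IsVarElim.exists_isHom (hV : P.IsVarElim) (hP : P.Irreducible) {W E : Type}
    {I : CSPInstance W E} (hI : I.ArcConsistent) {x : W} (hx : x ∈ I.X)
    (hno : ¬ I.CanEliminate x) (m : D → E) (hm : Set.MapsTo m P.e (I.dom x))
    (hinj : Set.InjOn m P.e) :
    ∃ φ ψ, P.IsHom I.toPattern x φ ψ ∧ ∀ a ∈ P.e, ψ (P.vbar, a) = (x, m a) := by
  rw [← hP.occursAt_iff]
  by_contra hcon
  exact hno (hV W E I hI x hx ⟨m, hm, hinj, hcon⟩)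

end QPattern

/-! ### Arc-consistent instances whose variable `0` cannot be eliminated -/

namespace Obstructions

open CSPInstance QPattern

/-! ### A triangle of disequalities -/

theorem diff_symm {W E : Type*} (f : E → Bool) (p q : W × E) (_ : p.1 ≠ q.1) :
    (f p.2 != f q.2) = (f q.2 != f p.2) := by
  cases f p.2 <;> cases f q.2 <;> rfl

/-- The triangle of disequalities, in which the values of each variable are split into two classes
by `f`. -/
def triangle {E : Type*} [Finite E] [Nonempty E] (f : E → Bool) : CSPInstance (Fin 3) E :=
  ofRel (fun p q => f p.2 != f q.2) (diff_symm f)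

theorem triangle_arcConsistent {E : Type*} [Finite E] [Nonempty E] {f : E → Bool}
    (hf : f.Surjective) : (triangle f).ArcConsistent := by
  refine ofRel_arcConsistent fun v a w _ => ?_
  obtain ⟨b, hb⟩ := hf (!f a)
  exact ⟨b, by simp [hb]⟩

theorem triangle_not_canEliminate {E : Type*} [Finite E] [Nonempty E] {f : E → Bool}
    (hf : f.Surjective) : ¬ (triangle f).CanEliminate 0 := by
  obtain ⟨g, hg⟩ := hf.hasRightInverse
  refine ofRel_not_canEliminate (fun v => g (v == 1)) ?_ fun t => ?_
  · simp only [hg _]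
    decide
  · by_contra! h
    have h1 := h 0 1 (by decide)
    have h2 := h 0 2 (by decide)
    have h3 := h 1 2 (by decide)
    revert h1 h2 h3
    cases f (t 0) <;> cases f (t 1) <;> cases f (t 2) <;> simp

variable {V D : Type*} {P : QPattern V D}

/-- The value mapping must be injective, so the class `false` is first enlarged to receive every
existential value separately; the classes are then collapsed to two values. -/
theorem exists_isHom_triangle (hV : P.IsVarElim) (hP : P.Irreducible) :
    ∃ φ ψ, P.IsHom (triangle (id : Bool → Bool)).toPattern 0 φ ψ ∧
      ∀ a ∈ P.e, ψ (P.vbar, a) = (0, false) := by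
  classical
  have hfin : P.e.Finite :=
    (P.finite_A.image Prod.snd).subset fun a ha => ⟨(P.vbar, a), P.e_subset a ha, rfl⟩
  have := hfin.to_subtype
  obtain ⟨n, ⟨g⟩⟩ := Finite.exists_equiv_fin P.e
  -- The extra value `some none` keeps the class `false` non-empty when there is no existential
  -- value.
  let f : Option (Option (Fin n)) → Bool := Option.isNone
  have hf : f.Surjective := fun b => by
    cases b
    · exact ⟨some none, rfl⟩
    · exact ⟨none, rfl⟩
  obtain ⟨φ, ψ, h, he⟩ := hV.exists_isHom hP (triangle_arcConsistent hf) (Set.mem_univ 0)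
    (triangle_not_canEliminate hf) (fun a => some (if ha : a ∈ P.e then some (g ⟨a, ha⟩) else none))
    (fun _ _ => Set.mem_univ _) (by
      intro a ha b hb hab
      simpa [ha, hb] using hab)
  refine ⟨φ, fun p => ((ψ p).1, f (ψ p).2), ⟨h.inj, fun _ _ => Set.mem_univ _,
    fun _ _ => Set.mem_univ _, h.fst, h.cpt, h.vbar⟩, fun a ha => ?_⟩
  simp [he a ha, f]

/-! ### An instance of four variables in which a value of `0` supports at most one `0` -/

/-- A value of variable `0` forces the value `1` on all other variables but the one it names, hence
on at least two, while two values `1` at these variables are incompatible. The value `0` names no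
other variable and supports only the value `1`; it receives the existential value. -/
def satRel (p q : Fin 4 × Fin 4) : Bool :=
  if p.1 = 0 then q.2 = 1 || p.2 = q.1
  else if q.1 = 0 then p.2 = 1 || q.2 = p.1
  else !(p.2 = 1 && q.2 = 1)

theorem satRel_symm : ∀ p q, p.1 ≠ q.1 → satRel p q = satRel q p := by decide +kernel

def sat : CSPInstance (Fin 4) (Fin 4) := ofRel satRel satRel_symm

theorem sat_arcConsistent : sat.ArcConsistent := ofRel_arcConsistent (by decide +kernel)

theorem sat_not_canEliminate : ¬ sat.CanEliminate 0 := by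
  refine ofRel_not_canEliminate (fun _ => 0) (by decide +kernel) fun t => ?_
  have h : ∀ a b c d : Fin 4, ∃ v w, v ≠ w ∧
      satRel (v, ![a, b, c, d] v) (w, ![a, b, c, d] w) = false := by decide +kernel
  have ht : ![t 0, t 1, t 2, t 3] = t := by ext i; fin_cases i <;> rfl
  simpa only [ht] using h (t 0) (t 1) (t 2) (t 3)

/-! ### An instance of four variables in which a value of `0` is incompatible with at most one
value -/

/-- Variables `2` and `3` must be equal, and each value of `0` forces one of them, hence both, to be
`true`; variable `1` then has no value left. -/
def sparseRel (p q : Fin 4 × Bool) : Bool :=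
  let l : List ((Fin 4 × Bool) × (Fin 4 × Bool)) :=
    [((0, false), (3, false)), ((0, true), (2, false)), ((1, false), (3, true)),
      ((1, true), (2, true)), ((2, false), (3, true)), ((2, true), (3, false))]
  !((p, q) ∈ l || (q, p) ∈ l)

theorem sparseRel_symm : ∀ p q, p.1 ≠ q.1 → sparseRel p q = sparseRel q p := by decide +kernel

def sparse : CSPInstance (Fin 4) Bool := ofRel sparseRel sparseRel_symm

theorem sparse_arcConsistent : sparse.ArcConsistent := ofRel_arcConsistent (by decide +kernel)

theorem sparse_not_canEliminate : ¬ sparse.CanEliminate 0 := by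
  refine ofRel_not_canEliminate (fun _ => false) (by decide +kernel) fun t => ?_
  have h : ∀ a b c d : Bool, ∃ v w, v ≠ w ∧
      sparseRel (v, ![a, b, c, d] v) (w, ![a, b, c, d] w) = false := by decide +kernel
  have ht : ![t 0, t 1, t 2, t 3] = t := by ext i; fin_cases i <;> rfl
  simpa only [ht] using h (t 0) (t 1) (t 2) (t 3)

/-! ### Instances made of unsolvable triangles on the values `1` and `2` -/

/-- The values `1`, `2` differ, and are separated from `0`. -/
def split (a b : Fin 3) : Bool := (a = 0 && b = 0) || (a ≠ 0 && b ≠ 0 && a ≠ b)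

/-- One triangle. The value `0` of the variable `0` is compatible with the triangle only. -/
def guardedRel (p q : Fin 4 × Fin 3) : Bool :=
  if p.1 = 0 then guard p q else if q.1 = 0 then guard q p else split p.2 q.2
where guard (p q : Fin 4 × Fin 3) : Bool :=
  if p.2 = 0 then q.2 ≠ 0 else ((p.2 = 1) ^^ (q.1 = 3)) = (q.2 = 0)

theorem guardedRel_symm : ∀ p q, p.1 ≠ q.1 → guardedRel p q = guardedRel q p := by decide +kernel

def guarded : CSPInstance (Fin 4) (Fin 3) := ofRel guardedRel guardedRel_symm

theorem guarded_arcConsistent : guarded.ArcConsistent := ofRel_arcConsistent (by decide +kernel)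

theorem guarded_not_canEliminate : ¬ guarded.CanEliminate 0 := by
  -- The value `0` of variable `0` forces a two-valued triangle of disequalities; its other values
  -- force zero and nonzero values together, which `split` forbids.
  refine ofRel_not_canEliminate (fun _ => 0) (by decide +kernel) fun t => ?_
  have h : ∀ a b c d : Fin 3, ∃ v w, v ≠ w ∧
      guardedRel (v, ![a, b, c, d] v) (w, ![a, b, c, d] w) = false := by decide +kernel
  have ht : ![t 0, t 1, t 2, t 3] = t := by ext i; fin_cases i <;> rfl
  simpa only [ht] using h (t 0) (t 1) (t 2) (t 3)

/-- Two triangles. Each value of the variable `0` forces one of them. -/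
def twoTrianglesRel (p q : Fin 7 × Fin 3) : Bool :=
  if p.1 = 0 then guard p q else if q.1 = 0 then guard q p
  else if (p.1 ≤ 3) = (q.1 ≤ 3) then split p.2 q.2 else true
where guard (p q : Fin 7 × Fin 3) : Bool := ((p.2 = 0) ^^ (q.1 ≤ 3)) || q.2 ≠ 0

theorem twoTrianglesRel_symm :
    ∀ p q, p.1 ≠ q.1 → twoTrianglesRel p q = twoTrianglesRel q p := by decide +kernel

def twoTriangles : CSPInstance (Fin 7) (Fin 3) := ofRel twoTrianglesRel twoTrianglesRel_symm

theorem twoTriangles_arcConsistent : twoTriangles.ArcConsistent :=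
  ofRel_arcConsistent (by decide +kernel)

theorem twoTriangles_not_canEliminate : ¬ twoTriangles.CanEliminate 0 := by
  refine ofRel_not_canEliminate (fun _ => 0) (by decide +kernel) fun t => ?_
  by_contra! h
  -- Checking only the triangle forced by `a` avoids enumerating all assignments of seven variables.
  have key : ∀ a : Fin 3, ∃ u v w : Fin 7, (0 ≠ u ∧ 0 ≠ v ∧ 0 ≠ w ∧ u ≠ v ∧ u ≠ w ∧ v ≠ w) ∧
      ∀ b c d : Fin 3, twoTrianglesRel (0, a) (u, b) → twoTrianglesRel (0, a) (v, c) →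
      twoTrianglesRel (0, a) (w, d) → twoTrianglesRel (u, b) (v, c) →
      twoTrianglesRel (u, b) (w, d) → ¬ twoTrianglesRel (v, c) (w, d) := by
    decide +kernel
  simp only [ne_eq, Bool.not_eq_false] at h
  obtain ⟨u, v, w, ⟨h1, h2, h3, h4, h5, h6⟩, huvw⟩ := key (t 0)
  exact huvw _ _ _ (h 0 u h1) (h 0 v h2) (h 0 w h3) (h u v h4) (h u w h5) (h v w h6)

end Obstructions

/-! ### Exhaustive classification of edge tables -/

namespace EdgeTables

open VarElimPatterns

/-! A pattern on the variables `x`, `y`, `z` in the triangle of disequalities is given by the tables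
`X`, `Z`, `Y` of its edges between `x` and `y`, `x` and `z`, `y` and `z`; edges between different
values are compatibility edges, edges between equal values are incompatibility edges. The flag `e`
says that `x` has the existential value `false`. -/

/-- No reduction is possible at a variable whose edges are given by the tables `X` and `Z`. -/
abbrev Unreducible (X Z : Bool → Bool → Bool) (e : Bool) : Prop :=
  ((∃ d, X true d ∨ Z true d) → (e = true ∨ ∃ d, X false d ∨ Z false d) →
    ∃ d, (X false d ∧ X true d) ∨ (Z false d ∧ Z true d)) ∧
  ∀ a, (e = true ∧ a = false) ∨ ¬ (X a !a ∨ Z a !a) ∨ X a a ∨ Z a a ∨ (X a !a ∧ Z a !a)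

/-- The pattern contains none of a list of patterns that do not allow variable elimination. -/
structure Avoids (X Z Y : Bool → Bool → Bool) (e : Bool) : Prop where
  sparse : ∀ a, ¬ (X a a ∧ Z a a)
  sat₁ : ∀ a, ¬ (X a a ∧ Y a a)
  sat₂ : ∀ a, ¬ (X a a ∧ X (!a) (!a) ∧ X (!a) a)
  sat₃ : ∀ a, ¬ (Y a a ∧ Y (!a) (!a) ∧ Y (!a) a)
  twoTriangles : ∀ a, ¬ (Z a a ∧ Y (!a) (!a) ∧ X a (!a) ∧ Y (!a) a)
  sat₄ : ∀ a, ¬ (Z a a ∧ X (!a) a ∧ Z (!a) a ∧ Z a (!a) ∧ Y a (!a))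
  sat₅ : ∀ a, ¬ (Y a a ∧ X a (!a) ∧ Z a (!a) ∧ Y (!a) a ∧ Y a (!a))
  sat₆ : e = true → ¬ (X true true ∧ X false true)
  guarded : e = true → ¬ (Z false false ∧ X false true ∧ Y true false)
  sat₇ : e = true → ¬ (Y false false ∧ X false true ∧ Y true false)

theorem avoids_iff {X Z Y : Bool → Bool → Bool} {e : Bool} : Avoids X Z Y e ↔
    (∀ a, ¬ (X a a ∧ Z a a)) ∧
    (∀ a, ¬ (X a a ∧ Y a a)) ∧
    (∀ a, ¬ (X a a ∧ X (!a) (!a) ∧ X (!a) a)) ∧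
    (∀ a, ¬ (Y a a ∧ Y (!a) (!a) ∧ Y (!a) a)) ∧
    (∀ a, ¬ (Z a a ∧ Y (!a) (!a) ∧ X a (!a) ∧ Y (!a) a)) ∧
    (∀ a, ¬ (Z a a ∧ X (!a) a ∧ Z (!a) a ∧ Z a (!a) ∧ Y a (!a))) ∧
    (∀ a, ¬ (Y a a ∧ X a (!a) ∧ Z a (!a) ∧ Y (!a) a ∧ Y a (!a))) ∧
    (e = true → ¬ (X true true ∧ X false true)) ∧
    (e = true → ¬ (Z false false ∧ X false true ∧ Y true false)) ∧
    (e = true → ¬ (Y false false ∧ X false true ∧ Y true false)) :=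
  ⟨fun ⟨h1, h2, h3, h4, h5, h6, h7, h8, h9, h10⟩ => ⟨h1, h2, h3, h4, h5, h6, h7, h8, h9, h10⟩,
    fun ⟨h1, h2, h3, h4, h5, h6, h7, h8, h9, h10⟩ => ⟨h1, h2, h3, h4, h5, h6, h7, h8, h9, h10⟩⟩

set_option synthInstance.maxHeartbeats 400000 in
set_option synthInstance.maxSize 1000 in
instance (X Z Y : Bool → Bool → Bool) (e : Bool) : Decidable (Avoids X Z Y e) :=
  decidable_of_iff' _ avoids_iff

def val (a : Bool) : Fin 2 := if a then 1 else 0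

/-- Renaming the values of `x`, `y`, `z` by `f`, `g`, `h` maps the edges into those of the pattern
with edges `T`, `F`. -/
abbrev MapsTo (X Z Y : Bool → Bool → Bool) (e : Bool) (T F : List (Asg × Asg)) (y z : Fin 3)
    (f g h : Bool) : Prop :=
  (∀ a d, X a d → edges T F (0, val (a ^^ f)) (y, val (d ^^ g)) = some (a != d)) ∧
  (∀ a d, Z a d → edges T F (0, val (a ^^ f)) (z, val (d ^^ h)) = some (a != d)) ∧
  (∀ a d, Y a d → edges T F (y, val (a ^^ g)) (z, val (d ^^ h)) = some (a != d)) ∧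
  (e = true → f = false)

/-- The edges of the four patterns, and whether they have an existential value. -/
def fourEdges : List (Bool × List (Asg × Asg) × List (Asg × Asg)) :=
  [(false, [(y0, z0), (y0, x1), (z0, x0)], [(y0, x0), (z0, x1)]),
    (true, [(y0, z0), (y0, x1)], [(y0, x0), (z0, x1)]),
    (true, [(y1, x0), (z0, x0)], [(y0, x0), (z0, y1)]),
    (true, [(y1, x0), (y0, z0)], [(y0, x0), (z0, y1)])]

theorem exists_mem_four {q : Bool × List (Asg × Asg) × List (Asg × Asg)} (hq : q ∈ fourEdges) :
    ∃ Q ∈ four, Q.cpt = edges q.2.1 q.2.2 ∧ Q.X = Set.univ ∧ Q.vbar = 0 ∧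
      (q.1 = true → (0 : Fin 2) ∈ Q.e) := by
  simp only [fourEdges, List.mem_cons, List.not_mem_nil, or_false] at hq
  rcases hq with rfl | rfl | rfl | rfl
  · exact ⟨BTP, by simp [four], rfl, rfl, rfl, by simp⟩
  · exact ⟨existsSubBTP, by simp [four], rfl, rfl, rfl, fun _ => rfl⟩
  · exact ⟨existsInvsubBTP, by simp [four], rfl, rfl, rfl, fun _ => rfl⟩
  · exact ⟨existsSnake, by simp [four], rfl, rfl, rfl, fun _ => rfl⟩

abbrev MapsToFour (X Z Y : Bool → Bool → Bool) (e : Bool) : Prop :=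
  ∃ q ∈ fourEdges, (e = true → q.1 = true) ∧ ∃ y z : Fin 3, (y ≠ 0 ∧ z ≠ 0 ∧ y ≠ z) ∧
    ∃ f g h, MapsTo X Z Y e q.2.1 q.2.2 y z f g h

instance (X Z : Bool → Bool → Bool) (e : Bool) : Decidable (Unreducible X Z e) := by
  unfold Unreducible; infer_instance

instance (X Z Y : Bool → Bool → Bool) (e : Bool) (T F : List (Asg × Asg)) (y z : Fin 3)
    (f g h : Bool) : Decidable (MapsTo X Z Y e T F y z f g h) := by
  unfold MapsTo; infer_instance

instance (X Z Y : Bool → Bool → Bool) (e : Bool) : Decidable (MapsToFour X Z Y e) := by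
  unfold MapsToFour; infer_instance

/-- The table with binary code `n`. -/
def ofCode (n : Fin 16) (a d : Bool) : Bool := n.1.testBit (2 * a.toNat + d.toNat)

theorem exists_ofCode (X : Bool → Bool → Bool) : ∃ n, ofCode n = X := by
  have h : ∀ a b c d, ∃ n, ofCode n false false = a ∧ ofCode n false true = b ∧
      ofCode n true false = c ∧ ofCode n true true = d := by decide
  obtain ⟨n, h1, h2, h3, h4⟩ := h (X false false) (X false true) (X true false) (X true true)
  refine ⟨n, funext fun a => funext fun d => ?_⟩
  cases a <;> cases d <;> assumption

/-- The conditions on the two tables at `x` come before the third table is quantified, so that most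
cases are discarded early. -/
theorem mapsToFour_ofCode : ∀ e : Bool, ∀ i j : Fin 16,
    (∀ a, ¬ (ofCode i a a ∧ ofCode j a a)) → Unreducible (ofCode i) (ofCode j) e → ∀ k : Fin 16,
    Unreducible (fun a d => ofCode i d a) (ofCode k) false →
    Unreducible (fun a d => ofCode j d a) (fun a d => ofCode k d a) false →
    Avoids (ofCode i) (ofCode j) (ofCode k) e →
    Avoids (ofCode j) (ofCode i) (fun a d => ofCode k d a) e →
    MapsToFour (ofCode i) (ofCode j) (ofCode k) e := by
  decide +kernel

theorem mapsToFour {X Z Y : Bool → Bool → Bool} {e : Bool} (h₁ : Avoids X Z Y e)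
    (h₂ : Avoids Z X (fun a d => Y d a) e) (h₃ : Unreducible X Z e)
    (h₄ : Unreducible (fun a d => X d a) Y false)
    (h₅ : Unreducible (fun a d => Z d a) (fun a d => Y d a) false) : MapsToFour X Z Y e := by
  obtain ⟨i, rfl⟩ := exists_ofCode X
  obtain ⟨j, rfl⟩ := exists_ofCode Z
  obtain ⟨k, rfl⟩ := exists_ofCode Y
  exact mapsToFour_ofCode e i j h₁.sparse h₃ k h₄ h₅ h₁ h₂

end EdgeTables

/-! ### Necessity: from a pattern to its edge tables -/

namespace Obstructions

open CSPInstance QPattern VarElimPatterns EdgeTables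

variable {V D : Type*} {P : QPattern V D} {φ : V → Fin 3} {ψ : V × D → Fin 3 × Bool}

/-- The image of `P` under `ψ` has an edge between `(v, a)` and `(w, d)`. -/
def Link (P : QPattern V D) (ψ : V × D → Fin 3 × Bool) (v : Fin 3) (a : Bool) (w : Fin 3)
    (d : Bool) : Prop :=
  ∃ p ∈ P.A, ∃ q ∈ P.A, ψ p = (v, a) ∧ ψ q = (w, d) ∧ P.cpt p q ≠ none

theorem Link.symm {v w : Fin 3} {a d : Bool} (h : Link P ψ v a w d) : Link P ψ w d v a := by
  obtain ⟨p, hp, q, hq, h1, h2, h3⟩ := h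
  exact ⟨q, hq, p, hp, h2, h1, by rwa [P.cpt_symm]⟩

open Classical in
/-- The table of edges between two variables. -/
noncomputable def table (P : QPattern V D) (ψ : V × D → Fin 3 × Bool) (v w : Fin 3) (a d : Bool) :
    Bool :=
  decide (Link P ψ v a w d)

theorem table_iff {v w : Fin 3} {a d : Bool} : table P ψ v w a d = true ↔ Link P ψ v a w d := by
  simp [table]

theorem table_symm (v w : Fin 3) : (fun a d => table P ψ v w d a) = table P ψ w v := by
  funext a d
  rw [Bool.eq_iff_iff, table_iff, table_iff]
  exact ⟨Link.symm, Link.symm⟩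

theorem subsingleton_e (hP : P.Irreducible) (h : P.IsHom (triangle id).toPattern 0 φ ψ)
    (he : ∀ a ∈ P.e, ψ (P.vbar, a) = (0, false)) : P.e.Subsingleton := by
  intro a ha b hb
  have := h.injOn hP (P.e_subset a ha) (P.e_subset b hb) ((he a ha).trans (he b hb).symm)
  exact (Prod.ext_iff.1 this).2

/-- The edges of `P` can be found in any instance in which `0` cannot be eliminated. -/
theorem exists_realization (hV : P.IsVarElim) (hP : P.Irreducible)
    (h : P.IsHom (triangle id).toPattern 0 φ ψ) (he : ∀ a ∈ P.e, ψ (P.vbar, a) = (0, false))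
    {W E : Type} [Finite W] [Finite E] [Nonempty E] [DecidableEq W] {r : W × E → W × E → Bool}
    {hr : ∀ p q, p.1 ≠ q.1 → r p q = r q p} (hI : (ofRel r hr).ArcConsistent) {x : W}
    (hx : ¬ (ofRel r hr).CanEliminate x) (c : E) :
    ∃ (σ : Fin 3 → W) (θ : Fin 3 → Bool → E), σ 0 = x ∧
      (P.e.Nonempty → θ 0 false = c) ∧
      (∀ v a w d, Link P ψ v a w d → r (σ v, θ v a) (σ w, θ w d) = (a != d)) ∧
      (∀ v a w d, Link P ψ v a w d → v ≠ 0 → σ v ≠ x) ∧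
      ∀ v a w d v' a' w' d', Link P ψ v a w d → Link P ψ v' a' w' d' → v ≠ v' → σ v ≠ σ v' := by
  have hsub := subsingleton_e hP h he
  obtain ⟨φ', ψ', h', he'⟩ := hV.exists_isHom hP hI (Set.mem_univ x) hx (fun _ => c)
    (fun _ _ => Set.mem_univ _) (fun a ha b hb _ => hsub ha hb)
  -- `σ` and `θ` are `φ'` and `ψ'` read through the inverses of `φ` and `ψ`. Off the image they take
  -- the defaults `x` and `c`, so the distinctness conclusions require links.
  have hσ : ∀ v, ∃ u, ∀ w ∈ P.X, φ w = v → φ' w = u := by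
    intro v
    by_cases hv : ∃ w ∈ P.X, φ w = v
    · obtain ⟨w, hw, rfl⟩ := hv
      exact ⟨φ' w, fun w' hw' hww => congrArg φ' (h.inj hw' hw hww)⟩
    · exact ⟨x, fun w hw hwv => absurd ⟨w, hw, hwv⟩ hv⟩
  have hθ : ∀ v a, ∃ b, ∀ p ∈ P.A, ψ p = (v, a) → (ψ' p).2 = b := by
    intro v a
    by_cases hv : ∃ p ∈ P.A, ψ p = (v, a)
    · obtain ⟨p, hp, hpv⟩ := hv
      exact ⟨(ψ' p).2, fun q hq hqv => congrArg (fun r => (ψ' r).2)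
        (h.injOn hP hq hp (hqv.trans hpv.symm))⟩
    · exact ⟨c, fun w hw hwv => absurd ⟨w, hw, hwv⟩ hv⟩
  choose σ hσ using hσ
  choose θ hθ using hθ
  have hψ' : ∀ p ∈ P.A, ∀ v a, ψ p = (v, a) → ψ' p = (σ v, θ v a) := by
    intro p hp v a hpv
    refine Prod.ext ((h'.fst p hp).trans (hσ v p.1 (P.fst_mem p hp) ?_)) (hθ v a p hp hpv)
    rw [← h.fst p hp, hpv]
  have hfst : ∀ p ∈ P.A, ∀ v a, ψ p = (v, a) → σ v = φ' p.1 := by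
    intro p hp v a hpv
    rw [← h'.fst p hp, hψ' p hp v a hpv]
  refine ⟨σ, θ, ?_, ?_, ?_, ?_, ?_⟩
  · rw [← h'.vbar, hσ 0 P.vbar P.vbar_mem h.vbar]
  · rintro ⟨a, ha⟩
    rw [← hθ 0 false _ (P.e_subset a ha) (he a ha), he' a ha]
  -- Both homomorphisms preserve the edge of `P`, whose sign in the triangle is `a != d`.
  · rintro v a w d ⟨p, hp, q, hq, h1, h2, h3⟩
    have h4 := h.cpt p hp q hq h3
    have h5 := h'.cpt p hp q hq h3
    rw [h1, h2] at h4
    rw [hψ' p hp v a h1, hψ' q hq w d h2, ← h4] at h5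
    obtain ⟨b, hb⟩ := Option.ne_none_iff_exists'.1 (h4 ▸ h3)
    rw [hb, ofRel_cpt_eq_some] at h5
    rw [triangle, ofRel_cpt_eq_some] at hb
    exact h5.2.trans hb.2.symm
  · rintro v a w d ⟨p, hp, q, hq, h1, h2, h3⟩ hv
    rw [hfst p hp v a h1, ← h'.vbar]
    refine fun heq => hv ?_
    have := h.fst p hp
    rw [h1, h'.inj (P.fst_mem p hp) P.vbar_mem heq, h.vbar] at this
    exact this
  · rintro v a w d v' a' w' d' ⟨p, hp, q, hq, h1, h2, h3⟩ ⟨p', hp', q', hq', h1', h2', h3'⟩ hv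
    rw [hfst p hp v a h1, hfst p' hp' v' a' h1']
    refine fun heq => hv ?_
    have e1 := h.fst p hp
    have e2 := h.fst p' hp'
    rw [h1] at e1
    rw [h1', ← h'.inj (P.fst_mem p hp) (P.fst_mem p' hp') heq] at e2
    exact e1.trans e2.symm

/-- The patterns that do not occur in one of the obstructions. -/
theorem avoids_table (hV : P.IsVarElim) (hP : P.Irreducible)
    (h : P.IsHom (triangle id).toPattern 0 φ ψ) (he : ∀ a ∈ P.e, ψ (P.vbar, a) = (0, false))
    {v w : Fin 3} (hv : v ≠ 0) (hw : w ≠ 0) (hvw : v ≠ w) {e : Bool}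
    (hee : e = true → P.e.Nonempty) :
    Avoids (table P ψ 0 v) (table P ψ 0 w) (table P ψ v w) e := by
  obtain ⟨σ, θ, h0, h1, h2, h3, h4⟩ :=
    exists_realization hV hP h he sat_arcConsistent sat_not_canEliminate 0
  obtain ⟨σ', θ', h0', -, h2', h3', h4'⟩ :=
    exists_realization hV hP h he sparse_arcConsistent sparse_not_canEliminate false
  obtain ⟨τ, ρ, k0, -, k2, k3, k4⟩ :=
    exists_realization hV hP h he twoTriangles_arcConsistent twoTriangles_not_canEliminate 0
  obtain ⟨τ', ρ', k0', k1', k2', k3', -⟩ :=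
    exists_realization hV hP h he guarded_arcConsistent guarded_not_canEliminate 0
  have r2 : ∀ a w d, Link P ψ 0 a w d → satRel (0, θ 0 a) (σ w, θ w d) = (a != d) := fun a w d hl =>
    h0 ▸ h2 0 a w d hl
  have r2' : ∀ a w d, Link P ψ 0 a w d → sparseRel (0, θ' 0 a) (σ' w, θ' w d) = (a != d) :=
    fun a w d hl => h0' ▸ h2' 0 a w d hl
  have s2 : ∀ a w d, Link P ψ 0 a w d → twoTrianglesRel (0, ρ 0 a) (τ w, ρ w d) = (a != d) :=
    fun a w d hl => k0 ▸ k2 0 a w d hl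
  have s2' : ∀ a w d, Link P ψ 0 a w d → guardedRel (0, ρ' 0 a) (τ' w, ρ' w d) = (a != d) :=
    fun a w d hl => k0' ▸ k2' 0 a w d hl
  constructor
  all_goals simp only [table_iff]
  · have fact : ∀ y z : Fin 4, y ≠ 0 → z ≠ 0 → y ≠ z → ∀ a c d : Bool,
        sparseRel (0, a) (y, c) = false → sparseRel (0, a) (z, d) = false → False := by
      decide +kernel
    rintro (_ | _) ⟨X, Z⟩ <;>
      exact fact _ _ (h3' _ _ _ _ X.symm hv) (h3' _ _ _ _ Z.symm hw)
        (h4' _ _ _ _ _ _ _ _ X.symm Z.symm hvw) _ _ _ (r2' _ _ _ X) (r2' _ _ _ Z)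
  · have fact : ∀ y z : Fin 4, y ≠ 0 → z ≠ 0 → ∀ a c d : Fin 4,
        satRel (0, a) (y, c) = false → satRel (y, c) (z, d) = false → False := by
      decide +kernel
    rintro (_ | _) ⟨X, Y⟩ <;>
      exact fact _ _ (h3 _ _ _ _ Y hv) (h3 _ _ _ _ Y.symm hw) _ _ _ (r2 _ _ _ X) (h2 _ _ _ _ Y)
  · have fact : ∀ y : Fin 4, y ≠ 0 → ∀ a c : Fin 4, satRel (0, a) (y, c) = false →
        ∀ b d : Fin 4, satRel (0, b) (y, d) = false → satRel (0, b) (y, c) = true → False := by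
      decide +kernel
    rintro (_ | _) ⟨X, X', X''⟩ <;>
      exact fact _ (h3 _ _ _ _ X.symm hv) _ _ (r2 _ _ _ X) _ _ (r2 _ _ _ X') (r2 _ _ _ X'')
  · have fact : ∀ y z : Fin 4, y ≠ 0 → z ≠ 0 → ∀ a c : Fin 4, satRel (y, a) (z, c) = false →
        ∀ b d : Fin 4, satRel (y, b) (z, d) = false → satRel (y, b) (z, c) = true → False := by
      decide +kernel
    rintro (_ | _) ⟨Y, Y', Y''⟩ <;>
      exact fact _ _ (h3 _ _ _ _ Y hv) (h3 _ _ _ _ Y.symm hw) _ _ (h2 _ _ _ _ Y) _ _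
        (h2 _ _ _ _ Y') (h2 _ _ _ _ Y'')
  -- The first incompatibility gives `d = 0` with `z` in the triangle forced by `a`; the second puts
  -- `y` in the same triangle. So `c` is nonzero, and incompatible with `d`.
  · have fact : ∀ y z : Fin 7, y ≠ 0 → z ≠ 0 → ∀ a d : Fin 3,
        twoTrianglesRel (0, a) (z, d) = false → ∀ c d' : Fin 3,
        twoTrianglesRel (y, c) (z, d') = false → twoTrianglesRel (0, a) (y, c) = true →
        twoTrianglesRel (y, c) (z, d) = true → False := by
      decide +kernel
    rintro (_ | _) ⟨Z, Y, X, Y'⟩ <;>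
      exact fact _ _ (k3 _ _ _ _ Y hv) (k3 _ _ _ _ Y.symm hw) _ _ (s2 _ _ _ Z) _ _
        (k2 _ _ _ _ Y) (s2 _ _ _ X) (k2 _ _ _ _ Y')
  -- Here `d ≠ 1` and `a ≠ z`, so `b` names `z`, whence `c = 1` and `d' = 1`.
  · have fact : ∀ y z : Fin 4, y ≠ 0 → z ≠ 0 → y ≠ z → ∀ a d : Fin 4,
        satRel (0, a) (z, d) = false → ∀ b c : Fin 4, satRel (0, b) (y, c) = true →
        satRel (0, b) (z, d) = true → ∀ d' : Fin 4, satRel (0, a) (z, d') = true →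
        satRel (y, c) (z, d') = true → False := by
      decide +kernel
    rintro (_ | _) ⟨Z, X, Z', Z'', Y⟩ <;>
      exact fact _ _ (h3 _ _ _ _ Y hv) (h3 _ _ _ _ Y.symm hw)
        (h4 _ _ _ _ _ _ _ _ Y Y.symm hvw) _ _ (r2 _ _ _ Z) _ _ (r2 _ _ _ X) (r2 _ _ _ Z') _
        (r2 _ _ _ Z'') (h2 _ _ _ _ Y)
  -- Here `c = d = 1`, so `c' ≠ 1` and `a` names `y`, whence `d' = 1`.
  · have fact : ∀ y z : Fin 4, y ≠ 0 → z ≠ 0 → y ≠ z → ∀ c d : Fin 4,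
        satRel (y, c) (z, d) = false → ∀ a c' : Fin 4, satRel (0, a) (y, c') = true →
        ∀ d' : Fin 4, satRel (0, a) (z, d') = true → satRel (y, c') (z, d) = true →
        satRel (y, c) (z, d') = true → False := by
      decide +kernel
    rintro (_ | _) ⟨Y, X, Z, Y', Y''⟩ <;>
      exact fact _ _ (h3 _ _ _ _ Y hv) (h3 _ _ _ _ Y.symm hw)
        (h4 _ _ _ _ _ _ _ _ Y Y.symm hvw) _ _ (h2 _ _ _ _ Y) _ _ (r2 _ _ _ X) _ (r2 _ _ _ Z)
        (h2 _ _ _ _ Y') (h2 _ _ _ _ Y'')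
  · have fact : ∀ y : Fin 4, y ≠ 0 → ∀ a c : Fin 4, satRel (0, a) (y, c) = false →
        satRel (0, 0) (y, c) = true → False := by
      decide +kernel
    rintro hte ⟨X, X'⟩
    exact fact _ (h3 _ _ _ _ X.symm hv) _ _ (r2 _ _ _ X) (h1 (hee hte) ▸ r2 _ _ _ X')
  · have fact : ∀ y z : Fin 4, y ≠ 0 → z ≠ 0 → ∀ c d : Fin 3,
        guardedRel (0, 0) (z, d) = false → guardedRel (0, 0) (y, c) = true →
        guardedRel (y, c) (z, d) = true → False := by
      decide +kernel
    rintro hte ⟨Z, X, Y⟩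
    exact fact _ _ (k3' _ _ _ _ Y hv) (k3' _ _ _ _ Y.symm hw) _ _
      (k1' (hee hte) ▸ s2' _ _ _ Z) (k1' (hee hte) ▸ s2' _ _ _ X) (k2' _ _ _ _ Y)
  · have fact : ∀ y z : Fin 4, y ≠ 0 → z ≠ 0 → ∀ c d : Fin 4, satRel (y, c) (z, d) = false →
        ∀ c' : Fin 4, satRel (0, 0) (y, c') = true → satRel (y, c') (z, d) = true → False := by
      decide +kernel
    rintro hte ⟨Y, X, Y'⟩
    exact fact _ _ (h3 _ _ _ _ Y hv) (h3 _ _ _ _ Y.symm hw) _ _ (h2 _ _ _ _ Y) _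
      (h1 (hee hte) ▸ r2 _ _ _ X) (h2 _ _ _ _ Y')

/-- Irreducibility of the image at one variable. -/
theorem unreducible_table (hP : P.Irreducible) (h : P.IsHom (triangle id).toPattern 0 φ ψ)
    (he : ∀ a ∈ P.e, ψ (P.vbar, a) = (0, false)) {u v w : Fin 3} (huv : u ≠ v) (huw : u ≠ w)
    (hvw : v ≠ w) {e : Bool} (hee : e = true ↔ u = 0 ∧ P.e.Nonempty) :
    Unreducible (table P ψ u v) (table P ψ u w) e := by
  have hu : ∀ t, t ≠ u → t = v ∨ t = w := by
    have h3 : ∀ u v w : Fin 3, u ≠ v → u ≠ w → v ≠ w → ∀ t, t ≠ u → t = v ∨ t = w := by decide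
    exact h3 u v w huv huw hvw
  have hlink : ∀ p ∈ P.A, ∀ a, ψ p = (u, a) → ∀ q ∈ P.A, P.cpt p q ≠ none →
      P.cpt p q = some (a != (ψ q).2) ∧
      ((ψ q).1 = v ∧ Link P ψ u a v (ψ q).2 ∨ (ψ q).1 = w ∧ Link P ψ u a w (ψ q).2) := by
    intro p hp a hpa q hq hpq
    have h1 := h.cpt p hp q hq hpq
    obtain ⟨b, hb⟩ := Option.ne_none_iff_exists'.1 hpq
    rw [hb, triangle, ofRel_cpt_eq_some, hpa] at h1
    refine ⟨by rw [hb, ← h1.2]; rfl, ?_⟩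
    rcases hu _ h1.1.symm with h2 | h2
    · exact Or.inl ⟨h2, p, hp, q, hq, hpa, Prod.ext h2 rfl, hpq⟩
    · exact Or.inr ⟨h2, p, hp, q, hq, hpa, Prod.ext h2 rfl, hpq⟩
  have hpres : ∀ a, (∃ d, Link P ψ u a v d ∨ Link P ψ u a w d) → ∃ p ∈ P.A, ψ p = (u, a) := by
    rintro a ⟨d, ⟨p, hp, -, -, h1, -⟩ | ⟨p, hp, -, -, h1, -⟩⟩ <;> exact ⟨p, hp, h1⟩
  constructor
  · simp only [table_iff]
    intro h1 h2
    obtain ⟨⟨t, b⟩, hq, hqb⟩ := hpres _ h1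
    obtain ⟨⟨s, a⟩, hp, hpa⟩ : ∃ p ∈ P.A, ψ p = (u, false) := by
      rcases h2 with h2 | h2
      · obtain ⟨rfl, a, ha⟩ := hee.1 h2
        exact ⟨_, P.e_subset a ha, he a ha⟩
      · exact hpres _ h2
    have hst : t = s := by
      apply h.inj (P.fst_mem _ hq) (P.fst_mem _ hp)
      have e1 := h.fst _ hp
      have e2 := h.fst _ hq
      rw [hpa] at e1
      rw [hqb] at e2
      exact e2.symm.trans e1
    subst hst
    by_contra hcon
    -- Existential values all map to `false`, so merging the value over `true` into the one over
    -- `false` is never barred by them.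
    refine hP.1 t b a ⟨?_, hq, hp, fun r hr h3 h4 => absurd ?_ hcon, ?_⟩
    · rintro rfl
      simp [hpa] at hqb
    · rcases (hlink _ hq _ hqb r hr h3).2 with ⟨e1, e2⟩ | ⟨e1, e2⟩ <;>
        rcases (hlink _ hp _ hpa r hr h4).2 with ⟨e3, e4⟩ | ⟨e3, e4⟩
      · exact ⟨_, Or.inl ⟨e4, e2⟩⟩
      · exact absurd (e1.symm.trans e3) hvw
      · exact absurd (e3.symm.trans e1) hvw
      · exact ⟨_, Or.inr ⟨e4, e2⟩⟩
    · rintro rfl hb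
      simp [he b hb] at hqb
  · intro a
    simp only [table_iff]
    by_contra! hcon
    obtain ⟨h1, h2, h3, h4, h5⟩ := hcon
    obtain ⟨p, hp, hpa⟩ := hpres a ⟨!a, h2⟩
    have hb : ∀ b : Bool, b = a ∨ b = !a := by cases a <;> decide
    -- With no incompatibility edge at `a` and not both compatibility edges, the preimage of `(u,
    -- a)` would be dangling.
    refine hP.2 p ⟨hp, fun q hq r hr hpq hpr => ?_, fun q hq hpq => ?_, ?_⟩
    · apply h.injOn hP hq hr
      obtain ⟨-, hq'⟩ := hlink p hp a hpa q hq hpq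
      obtain ⟨-, hr'⟩ := hlink p hp a hpa r hr hpr
      rcases hb (ψ q).2 with e1 | e1 <;> rcases hb (ψ r).2 with e2 | e2 <;>
        rw [e1] at hq' <;> rw [e2] at hr'
      · exact absurd hq' (by simp [h3, h4])
      · exact absurd hq' (by simp [h3, h4])
      · exact absurd hr' (by simp [h3, h4])
      · refine Prod.ext ?_ (e1.trans e2.symm)
        rcases hq' with ⟨e3, e4⟩ | ⟨e3, e4⟩ <;> rcases hr' with ⟨e5, e6⟩ | ⟨e5, e6⟩
        · exact e3.trans e5.symm
        · exact absurd e6 (h5 e4)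
        · exact absurd e4 (h5 e6)
        · exact e3.trans e5.symm
    · obtain ⟨e1, e2⟩ := hlink p hp a hpa q hq (by simp [hpq])
      rw [hpq] at e1
      have e3 : (ψ q).2 = a := (by simpa using e1 : a = (ψ q).2).symm
      rw [e3] at e2
      rcases e2 with e2 | e2
      · exact h3 e2.2
      · exact h4 e2.2
    · obtain ⟨s, b⟩ := p
      rintro ⟨rfl, hbe⟩
      have e1 := he b hbe
      rw [hpa, Prod.mk.injEq] at e1
      exact h1 (hee.2 ⟨e1.1, b, hbe⟩) e1.2

theorem isSubpatternUpToEquiv_of_isVarElim (hV : P.IsVarElim) (hP : P.Irreducible) :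
    ∃ Q ∈ four, P.IsSubpatternUpToEquiv Q := by
  classical
  obtain ⟨φ, ψ, h, he⟩ := exists_isHom_triangle hV hP
  have hee : decide P.e.Nonempty = true → P.e.Nonempty := of_decide_eq_true
  have h₁ := avoids_table hV hP h he (v := 1) (w := 2) (by decide) (by decide) (by decide) hee
  have h₂ := avoids_table hV hP h he (v := 2) (w := 1) (by decide) (by decide) (by decide) hee
  have h₃ := unreducible_table hP h he (u := 0) (v := 1) (w := 2) (by decide) (by decide)
    (by decide) (e := decide P.e.Nonempty) (by simp)
  have h₄ := unreducible_table hP h he (u := 1) (v := 0) (w := 2) (by decide) (by decide)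
    (by decide) (e := false) (by simp)
  have h₅ := unreducible_table hP h he (u := 2) (v := 0) (w := 1) (by decide) (by decide)
    (by decide) (e := false) (by simp)
  rw [← table_symm 0 1] at h₄
  rw [← table_symm 0 2, ← table_symm 1 2] at h₅
  rw [← table_symm 1 2] at h₂
  obtain ⟨q, hq, hqe, y, z, ⟨hy, hz, hyz⟩, f, g, k, hX, hZ, hY, hf⟩ := mapsToFour h₁ h₂ h₃ h₄ h₅
  obtain ⟨Q, hQ, hc, hQX, hv, hQe⟩ := exists_mem_four hq
  refine ⟨Q, hQ, ?_⟩
  rw [hP.isSubpatternUpToEquiv_iff]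
  let α : Fin 3 → Fin 3 := ![0, y, z]
  -- The flags `f`, `g`, `k` record at which variables the two values are swapped.
  let β : Fin 3 × Bool → Asg := fun p => (α p.1, val (p.2 ^^ ![f, g, k] p.1))
  have hβ : ∀ v a w d, v ≠ w → Link P ψ v a w d → Q.cpt (β (v, a)) (β (w, d)) = some (a != d) := by
    have hlt : ∀ v a w d, v < w → Link P ψ v a w d →
        Q.cpt (β (v, a)) (β (w, d)) = some (a != d) := by
      intro v a w d hvw hl
      rw [← table_iff] at hl
      rw [hc]
      fin_cases v <;> fin_cases w <;> first
        | exact absurd hvw (by decide)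
        | exact hX a d hl
        | exact hZ a d hl
        | exact hY a d hl
    intro v a w d hvw hl
    rcases lt_or_gt_of_ne hvw with h1 | h1
    · exact hlt v a w d h1 hl
    · rw [Q.cpt_symm, hlt w d v a h1 hl.symm]
      cases a <;> cases d <;> rfl
  have hcpt : ∀ p ∈ P.A, ∀ q ∈ P.A, P.cpt p q ≠ none →
      Q.cpt (β (ψ p)) (β (ψ q)) = P.cpt p q := by
    intro p hp q hq hpq
    have h1 := h.cpt p hp q hq hpq
    obtain ⟨b, hb⟩ := Option.ne_none_iff_exists'.1 hpq
    rw [hb, triangle, ofRel_cpt_eq_some] at h1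
    rw [hb, ← h1.2]
    exact hβ _ _ _ _ h1.1 ⟨p, hp, q, hq, rfl, rfl, hpq⟩
  have hex : ∀ a ∈ P.e, β (ψ (P.vbar, a)) = (Q.vbar, 0) ∧ 0 ∈ Q.e := by
    intro a ha
    have h1 : decide P.e.Nonempty = true := decide_eq_true ⟨a, ha⟩
    rw [he a ha, hv]
    refine ⟨?_, hQe (hqe h1)⟩
    simp [β, α, hf h1, val]
  refine ⟨α ∘ φ, β ∘ ψ, ⟨?_, fun _ _ => hQX ▸ Set.mem_univ _, fun p hp => ?_, fun p hp => ?_, hcpt,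
    ?_⟩, fun a ha => ?_⟩
  · refine Function.Injective.comp_injOn ?_ h.inj
    intro i j
    fin_cases i <;> fin_cases j <;> simp [α, hy, hz, hyz, hy.symm, hz.symm, hyz.symm]
  -- An assignment of `P` that is not existential carries an edge, or it would be dangling; its
  -- image then lies on an edge of `Q`.
  · by_cases hpe : p.1 = P.vbar ∧ p.2 ∈ P.e
    · obtain ⟨s, a⟩ := p
      obtain ⟨rfl, ha⟩ := hpe
      rw [Function.comp_apply, (hex a ha).1]
      exact Q.e_subset 0 (hex a ha).2
    · obtain ⟨q, hq, hpq⟩ : ∃ q ∈ P.A, P.cpt p q ≠ none := by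
        by_contra! hcon
        exact hP.2 p ⟨hp, fun q hq _ _ h1 => absurd (hcon q hq) h1,
          fun q hq h1 => by simp [hcon q hq] at h1, hpe⟩
      have h1 := hcpt p hp q hq hpq
      exact (Q.cpt_dom _ _ (h1 ▸ hpq)).1
  · simp [β, h.fst p hp]
  · simp [h.vbar, hv, α]
  · rw [Function.comp_apply, (hex a ha).1]
    exact (hex a ha).2

end Obstructions

theorem mainTheorem1 (V D : Type*) :
    (∀ Q ∈ VarElimPatterns.four, Q.Irreducible ∧ Q.IsVarElim) ∧
    ∀ P : QPattern V D, P.NonemptyDomains → P.Irreducible →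
      (P.IsVarElim ↔ ∃ Q ∈ VarElimPatterns.four, P.IsSubpatternUpToEquiv Q) := by
  refine ⟨fun Q hQ => ⟨VarElimPatterns.irreducible_of_mem_four hQ,
    VarElimPatterns.isVarElim_of_mem_four hQ⟩, fun P _ hP => ⟨fun hV =>
    Obstructions.isSubpatternUpToEquiv_of_isVarElim hV hP, ?_⟩⟩
  rintro ⟨Q, hQ, hPQ⟩
  exact .of_isSubpatternUpToEquiv hP (VarElimPatterns.irreducible_of_mem_four hQ)
    (VarElimPatterns.isVarElim_of_mem_four hQ) (VarElimPatterns.subsingleton_e_of_mem_four hQ) hPQ
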